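/- **Setting.** Let $\Omega$ and $\mathcal X$ be metric spaces with their Borel $\sigma$-algebras, $\mu$ a Borel probability measure on $\Omega$ with compact support, and $(\Phi^t)_{t\ge 0}$ a semigroup ($\Phi^0=\mathrm{id}$, $\Phi^{s+t}=\Phi^s\circ\Phi^t$) of continuous $\mu$-preserving maps $\Omega\to\Omega$. Let $X:\Omega\to\mathcal X$ (covariate) and $Y:\Omega\to\mathbb C$ (response) be continuous, $U^\tau Y=Y\circ\Phi^\tau$, and $\mu_X=X_*\mu$. Fix $\Delta t>0$ and $\omega_1\in\Omega$, and put $\omega_j=\Phi^{(j-1)\Delta t}(\omega_1)$, $x_j=X(\omega_j)$, $y_j=Y(\omega_j)$, $\mu_n=\frac1n\sum_{j=1}^n\delta_{\omega_j}$, $\mu_{X,n}=\frac1n\sum_{j=1}^n\delta_{x_j}$. Inner products are conjugate-linear in the first argument. *Assumptions.* (a) $\int g\,d\mu_n\to\int g\,d\mu$ for every bounded continuous $g:\Omega\to\mathbb C$. (b) $\mathcal U\subseteq\mathcal X$ is a compact set containing $\operatorname{supp}\mu_X$ and all $x_j$, and for every $q\in\mathbb N_0$ the function $U^{q\Delta t}Y$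 is bounded on $X^{-1}(\mathcal U)$. (c) $\mathcal K$ and $\mathcal K_n$ ($n\in\mathbb N$) are reproducing kernel Hilbert spaces of complex functions on $\mathcal X$ with continuous kernels $k$, $k_n$, where $k(x,x')=\langle k_x,k_{x'}\rangle_{\mathcal K}$ and $f(x)=\langle k_x,f\rangle_{\mathcal K}$ (similarly for $k_n$), and $k_n\to k$ uniformly on $\mathcal U\times\mathcal U$. *Ideal target function.* Let $\iota:\mathcal K\to L^2(\mu_X)$ be the embedding, $G=\iota\iota^*$, $\lambda_1\ge\lambda_2\ge\cdots\ge 0$ the positive eigenvalues of $G$ repeated by multiplicity (followed by zeros if there are finitely many), $\phi_i$ corresponding orthonormal eigenfunctions, and $\psi_i=\lambda_i^{-1/2}\iota^*\phi_i$ for $\lambda_i>0$. Let $\Xi:L^2(\mu_X)\to L^2(\mu)$, $\Xi f=f\circ X$, and let $Z_\tau=\Xi^*U^\tau Y$ be the regression function. Put $$f_{\tau,\ell}=\sum_{i\le\ell,\ \lambda_i>0}\frac{\langle\phi_i,Z_\tau\rangle_{L^2(\mu_X)}}{\lambda_i^{1/2}}\,\psi_i\in\mathcal K ;$$ if $\lambda_\ell>0$,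 this is the unique minimizer of $\|\iota f-Z_\tau\|^2_{L^2(\mu_X)}$ over $f\in\operatorname{span}\{\psi_1,\dots,\psi_\ell\}$. *Empirical target function.* For $\tau=q\,\Delta t$, $q\in\mathbb N_0$, let $\iota_n:\mathcal K_n\to L^2(\mu_{X,n})$ be the embedding and let $\lambda_{i,n},\phi_{i,n},\psi_{i,n}$ be obtained from $G_n=\iota_n\iota_n^*$ in the same way. Let $\boldsymbol y_\tau=(y_{1+q},\dots,y_n,0,\dots,0)\in\mathbb C^n$, where $\mathbb C^n$ carries the normalized dot product, let $\Xi_n:L^2(\mu_{X,n})\to\mathbb C^n$, $\Xi_nf=(f(x_1),\dots,f(x_n))$, and $Z_{\tau,n}=\Xi_n^*\boldsymbol y_\tau$. Then $f_{\tau,\ell,n}=\sum_{i\le\ell,\ \lambda_{i,n}>0}\lambda_{i,n}^{-1/2}\langle\phi_{i,n},Z_{\tau,n}\rangle_{L^2(\mu_{X,n})}\,\psi_{i,n}\in\mathcal K_n$; if $\lambda_{\ell,n}>0$, it is the unique minimizer of $\|\iota_nf-Z_{\tau,n}\|^2_{L^2(\mu_{X,n})}$ over $f\in\operatorname{span}\{\psi_{1,n},\dots,\psi_{\ell,n}\}$.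 **Theorem.** Under these assumptions, for any choice of the orthonormal eigenfunctions: 1. For every $\tau\ge0$, $U^\tau Y\in L^2(\mu)$ and $\mathbb E[U^\tau Y\mid X]=Z_\tau\circ X$ $\mu$-a.e. 2. For every $\ell\ge1$ with $\lambda_\ell>0$ and $\lambda_{\ell+1}<\lambda_\ell$ (in particular whenever $\lambda_1,\dots,\lambda_\ell$ are positive and simple), and every $\tau=q\,\Delta t$, $q\in\mathbb N_0$, $f_{\tau,\ell,n}\to f_{\tau,\ell}$ as $n\to\infty$, uniformly on $\mathcal U$. The convergence is also uniform over the lead times $\tau=q\,\Delta t$ in any compact subset of $[0,\infty)$. 3. If $k$ is $L^2(\mu_X)$-strictly-positive (i.e. $\langle f,Gf\rangle>0$ for all nonzero $f\in L^2(\mu_X)$), then for every $\tau\ge0$, $\iota f_{\tau,\ell}\to Z_\tau$ in $L^2(\mu_X)$ as $\ell\to\infty$. The convergence is uniform over the lead times $\tau=q\,\Delta t$, $q\in\mathbb N_0$, in any compact subset of $[0,\infty)$; and if moreover $t\mapsto\Phi^t(\omega)$ is continuous for every $\omega\in\Omega$, it is uniform over all $\tau$ in any compact subset of $[0,\infty)$.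 Together, 2 and 3 give, for lead times $\tau=q\,\Delta t$, the iterated limit $\lim_{\ell}\lim_{n} f_{\tau,\ell,n}=\lim_{\ell} f_{\tau,\ell}=Z_\tau$, with the $n$-limit in $C(\mathcal U)$ (for $\ell$ as in 2) and the $\ell$-limit in $L^2(\mu_X)$. -/

import Mathlib

open MeasureTheory Filter Topology Set
open scoped NNReal ENNReal InnerProductSpace

namespace KAF

noncomputable section

/-! ### The spaces `L²(ρ)` and the pullback along a measurable map -/

/-- The `L²(μ)` class of a function `g` that is square integrable for `μ`
(and `0` for a function that is not). -/
def toL2 {S : Type*} [MeasurableSpace S] (μ : Measure S) (g : S → ℂ) : Lp ℂ 2 μ :=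
  open Classical in if h : MemLp g 2 μ then h.toLp g else 0

/-- The isometric embedding `Ξ : L²(μ_X) → L²(μ)`, `Ξ f = f ∘ X`, where `μ_X` is the
pushforward of `μ` under `X`. -/
def pullback {S T : Type*} [MeasurableSpace S] [MeasurableSpace T] (μ : Measure S)
    {X : S → T} (hX : Measurable X) : Lp ℂ 2 (μ.map X) →L[ℂ] Lp ℂ 2 μ :=
  (Lp.compMeasurePreservingₗᵢ ℂ X (hX.measurePreserving μ)).toContinuousLinearMap

/-- The regression function `Z = Ξ* g ∈ L²(μ_X)` of the response `g ∈ L²(μ)` given the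
covariate `X`. -/
def regression {S T : Type*} [MeasurableSpace S] [MeasurableSpace T] (μ : Measure S)
    {X : S → T} (hX : Measurable X) (g : S → ℂ) : Lp ℂ 2 (μ.map X) :=
  ContinuousLinearMap.adjoint (pullback μ hX) (toL2 μ g)

/-! ### Reproducing kernel Hilbert spaces and their embedding into `L²(ρ)` -/

/-- The complex-valued reproducing kernel `k(x, y) = ⟨k_x, k_y⟩` of an RKHS of complex functions
(inner products are conjugate-linear in the first argument). -/
def scalarKernel {𝒳 : Type*} (𝓚 : Type*) [NormedAddCommGroup 𝓚] [InnerProductSpace ℂ 𝓚]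
    [CompleteSpace 𝓚] [RKHS ℂ 𝓚 𝒳 ℂ] (x y : 𝒳) : ℂ :=
  RKHS.kernel 𝓚 x y 1

/-- If all elements of the RKHS are square integrable, the map taking a function to its `L²(ρ)`
class is a bounded operator (closed graph theorem). -/
def inclOfMemLp {𝒳 : Type*} [MeasurableSpace 𝒳] {𝓚 : Type*} [NormedAddCommGroup 𝓚]
    [InnerProductSpace ℂ 𝓚] [CompleteSpace 𝓚] [RKHS ℂ 𝓚 𝒳 ℂ] {ρ : Measure 𝒳}
    (h : ∀ f : 𝓚, MemLp (⇑f) 2 ρ) : 𝓚 →L[ℂ] Lp ℂ 2 ρ :=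
  let L : 𝓚 →ₗ[ℂ] Lp ℂ 2 ρ :=
    { toFun := fun f => (h f).toLp _
      map_add' := fun f g => by
        rw [← MemLp.toLp_add]
        exact MemLp.toLp_congr _ _ (by simp)
      map_smul' := fun c f => by
        rw [RingHom.id_apply, ← MemLp.toLp_const_smul]
        exact MemLp.toLp_congr _ _ (by simp) }
  { toLinearMap := L
    cont := by
      apply LinearMap.continuous_of_seq_closed_graph
      intro u x y hu hy
      obtain ⟨ns, _, hns⟩ :=
        (tendstoInMeasure_of_tendsto_Lp hy).exists_seq_tendsto_ae
      refine Lp.ext ?_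
      have h1 : ∀ᵐ a ∂ρ, ∀ i, (L (u (ns i)) : 𝒳 → ℂ) a = u (ns i) a :=
        ae_all_iff.2 fun i => (h (u (ns i))).coeFn_toLp
      filter_upwards [hns, h1, (h x).coeFn_toLp] with a ha1 ha2 ha3
      have h2 : Tendsto (fun i => u (ns i) a) atTop (𝓝 (x a)) :=
        ((RKHS.continuous_eval (𝕜 := ℂ) a).tendsto x).comp
          (hu.comp (StrictMono.tendsto_atTop ‹StrictMono ns›))
      have h3 : Tendsto (fun i => u (ns i) a) atTop (𝓝 (y a)) := by
        simpa [ha2] using ha1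
      rw [tendsto_nhds_unique h3 h2]
      exact ha3.symm }

/-- The embedding `ι_ρ : 𝓚 → L²(ρ)` of an RKHS whose elements are all square integrable for `ρ`
(and `0` if some element is not; `memLp_of_continuous_kernel` below shows that
this does not occur for a continuous kernel and a finite measure carried by a compact set). -/
def incl {𝒳 : Type*} [MeasurableSpace 𝒳] (𝓚 : Type*) [NormedAddCommGroup 𝓚]
    [InnerProductSpace ℂ 𝓚] [CompleteSpace 𝓚] [RKHS ℂ 𝓚 𝒳 ℂ] (ρ : Measure 𝒳) :
    𝓚 →L[ℂ] Lp ℂ 2 ρ :=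
  open Classical in if h : ∀ f : 𝓚, MemLp (⇑f) 2 ρ then inclOfMemLp h else 0

theorem coeFn_incl {𝒳 : Type*} [MeasurableSpace 𝒳] {𝓚 : Type*} [NormedAddCommGroup 𝓚]
    [InnerProductSpace ℂ 𝓚] [CompleteSpace 𝓚] [RKHS ℂ 𝓚 𝒳 ℂ] {ρ : Measure 𝒳}
    (h : ∀ f : 𝓚, MemLp (⇑f) 2 ρ) (f : 𝓚) : (incl 𝓚 ρ f : 𝒳 → ℂ) =ᵐ[ρ] ⇑f := by
  rw [incl, dif_pos h]
  exact (h f).coeFn_toLp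

theorem inner_kerFun_eq_scalarKernel {𝒳 : Type*} (𝓚 : Type*) [NormedAddCommGroup 𝓚]
    [InnerProductSpace ℂ 𝓚] [CompleteSpace 𝓚] [RKHS ℂ 𝓚 𝒳 ℂ] (x y : 𝒳) :
    ⟪RKHS.kerFun 𝓚 x (1 : ℂ), RKHS.kerFun 𝓚 y (1 : ℂ)⟫_ℂ = scalarKernel 𝓚 x y := by
  rw [RKHS.kerFun_inner, RKHS.kerFun_apply, scalarKernel]
  simp

/-- Elements of an RKHS with a continuous kernel are continuous functions. -/
theorem continuous_of_continuous_kernel {𝒳 : Type*} [TopologicalSpace 𝒳] {𝓚 : Type*}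
    [NormedAddCommGroup 𝓚] [InnerProductSpace ℂ 𝓚] [CompleteSpace 𝓚] [RKHS ℂ 𝓚 𝒳 ℂ]
    (hk : Continuous fun p : 𝒳 × 𝒳 => scalarKernel 𝓚 p.1 p.2) (f : 𝓚) : Continuous (⇑f) := by
  obtain ⟨κ, hκ⟩ : ∃ κ : 𝒳 → 𝓚, κ = fun x => RKHS.kerFun 𝓚 x (1 : ℂ) := ⟨_, rfl⟩
  have hK : ∀ x y, ⟪κ x, κ y⟫_ℂ = scalarKernel 𝓚 x y := by
    intro x y
    rw [hκ]
    exact inner_kerFun_eq_scalarKernel 𝓚 x y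
  have hf : (⇑f) = fun x => ⟪κ x, f⟫_ℂ := by
    funext x
    rw [hκ, RKHS.kerFun_inner]
    simp
  have hc : Continuous κ := by
    rw [continuous_iff_continuousAt]
    intro x
    rw [ContinuousAt, tendsto_iff_norm_sub_tendsto_zero]
    have h1 : ∀ y, ‖κ y - κ x‖ = Real.sqrt (scalarKernel 𝓚 y y - scalarKernel 𝓚 y x
        - scalarKernel 𝓚 x y + scalarKernel 𝓚 x x).re := by
      intro y
      rw [← hK, ← hK, ← hK, ← hK, ← inner_sub_sub_self, norm_eq_sqrt_re_inner (𝕜 := ℂ)]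
      rfl
    have h2 : Continuous fun y => Real.sqrt (scalarKernel 𝓚 y y - scalarKernel 𝓚 y x
        - scalarKernel 𝓚 x y + scalarKernel 𝓚 x x).re := by
      have a1 := hk.comp (continuous_id.prodMk continuous_id)
      have a2 := hk.comp (continuous_id.prodMk (continuous_const (y := x)))
      have a3 := hk.comp ((continuous_const (y := x)).prodMk continuous_id)
      simp only [Function.comp_def, id] at a1 a2 a3
      exact Real.continuous_sqrt.comp
        (Complex.continuous_re.comp (((a1.sub a2).sub a3).add continuous_const))
    have h3 := h2.tendsto x
    rw [← h1 x, sub_self, norm_zero] at h3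
    exact h3.congr fun y => (h1 y).symm
  rw [hf]
  exact hc.inner continuous_const

theorem memLp_of_continuous_kernel {𝒳 : Type*} [MetricSpace 𝒳] [MeasurableSpace 𝒳]
    [BorelSpace 𝒳] {𝓚 : Type*} [NormedAddCommGroup 𝓚] [InnerProductSpace ℂ 𝓚]
    [CompleteSpace 𝓚] [RKHS ℂ 𝓚 𝒳 ℂ]
    (hk : Continuous fun p : 𝒳 × 𝒳 => scalarKernel 𝓚 p.1 p.2) (ρ : Measure 𝒳)
    [IsFiniteMeasure ρ] {U : Set 𝒳} (hU : IsCompact U) (hρ : ρ Uᶜ = 0) (f : 𝓚) :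
    MemLp (⇑f) 2 ρ := by
  have hf := continuous_of_continuous_kernel hk f
  obtain ⟨C, hC⟩ := hU.exists_bound_of_continuousOn hf.continuousOn
  refine MemLp.of_bound hf.measurable.aestronglyMeasurable C ?_
  have : ∀ᵐ x ∂ρ, x ∈ U := hρ
  filter_upwards [this] with x hx using hC x hx

/-- The integral operator `G_ρ = ι_ρ ι_ρ*` on `L²(ρ)` induced by an RKHS. -/
def kernelOp {𝒳 : Type*} [MeasurableSpace 𝒳] (𝓚 : Type*) [NormedAddCommGroup 𝓚]
    [InnerProductSpace ℂ 𝓚] [CompleteSpace 𝓚] [RKHS ℂ 𝓚 𝒳 ℂ] (ρ : Measure 𝒳) :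
    Lp ℂ 2 ρ →L[ℂ] Lp ℂ 2 ρ :=
  incl 𝓚 ρ ∘L ContinuousLinearMap.adjoint (incl 𝓚 ρ)

/-- The reproducing kernel of `𝓚` is `L²(ρ)`-strictly-positive: `G_ρ` is a strictly positive
operator. -/
def IsL2StrictlyPositive {𝒳 : Type*} [MeasurableSpace 𝒳] (𝓚 : Type*) [NormedAddCommGroup 𝓚]
    [InnerProductSpace ℂ 𝓚] [CompleteSpace 𝓚] [RKHS ℂ 𝓚 𝒳 ℂ] (ρ : Measure 𝒳) : Prop :=
  ∀ f : Lp ℂ 2 ρ, f ≠ 0 → 0 < (⟪f, kernelOp 𝓚 ρ f⟫_ℂ).re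

/-! ### Eigenfunctions, hypothesis spaces, target functions -/

/-- `lam 0 ≥ lam 1 ≥ …` is the list of all positive eigenvalues of the positive compact operator
`G`, repeated according to multiplicity and followed by zeros if there are only finitely many,
and the `φ i` with `lam i > 0` are corresponding orthonormal eigenvectors. Completeness says that
`G` vanishes on the orthogonal complement of these eigenvectors. The vectors `φ i` with
`lam i = 0` play no role. Indices start at `0`. -/
structure IsEigensystem {H : Type*} [NormedAddCommGroup H] [InnerProductSpace ℂ H]
    (G : H →L[ℂ] H) (lam : ℕ → ℝ) (φ : ℕ → H) : Prop where
  antitone : Antitone lam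
  nonneg : ∀ i, 0 ≤ lam i
  orthonormal : Orthonormal ℂ fun i : {i : ℕ // 0 < lam i} => φ i
  eigen : ∀ i, 0 < lam i → G (φ i) = (lam i : ℂ) • φ i
  complete : ∀ f : H, (∀ i, 0 < lam i → ⟪φ i, f⟫_ℂ = 0) → G f = 0

/-- `ψ_i = ι* φ_i / λ_i ^ (1/2)`. -/
def psi {𝓚 H : Type*} [NormedAddCommGroup 𝓚] [InnerProductSpace ℂ 𝓚] [CompleteSpace 𝓚]
    [NormedAddCommGroup H] [InnerProductSpace ℂ H] [CompleteSpace H]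
    (ι : 𝓚 →L[ℂ] H) (lam : ℕ → ℝ) (φ : ℕ → H) (i : ℕ) : 𝓚 :=
  ((Real.sqrt (lam i) : ℂ)⁻¹) • ContinuousLinearMap.adjoint ι (φ i)

/-- The hypothesis space spanned by the first `ℓ` of the `ψ_i`. -/
def hypothesisSpace {𝓚 H : Type*} [NormedAddCommGroup 𝓚] [InnerProductSpace ℂ 𝓚]
    [CompleteSpace 𝓚] [NormedAddCommGroup H] [InnerProductSpace ℂ H] [CompleteSpace H]
    (ι : 𝓚 →L[ℂ] H) (lam : ℕ → ℝ) (φ : ℕ → H) (ℓ : ℕ) : Submodule ℂ 𝓚 :=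
  Submodule.span ℂ (psi ι lam φ '' {i | i < ℓ})

/-- The target function `T_ℓ Z = ∑_{i < ℓ} ⟨φ_i, Z⟩ / λ_i ^ (1/2) • ψ_i`, an element of the RKHS;
terms with `λ_i = 0` do not contribute. It is the unique minimizer of the excess error
`‖ι f - Z‖²` over the hypothesis space, see `target_minimizes`. -/
def target {𝓚 H : Type*} [NormedAddCommGroup 𝓚] [InnerProductSpace ℂ 𝓚] [CompleteSpace 𝓚]
    [NormedAddCommGroup H] [InnerProductSpace ℂ H] [CompleteSpace H]
    (ι : 𝓚 →L[ℂ] H) (lam : ℕ → ℝ) (φ : ℕ → H) (ℓ : ℕ) (Z : H) : 𝓚 :=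
  ∑ i ∈ Finset.range ℓ, (⟪φ i, Z⟫_ℂ / (Real.sqrt (lam i) : ℂ)) • psi ι lam φ i

theorem target_minimizes {𝓚 H : Type*} [NormedAddCommGroup 𝓚] [InnerProductSpace ℂ 𝓚]
    [CompleteSpace 𝓚] [NormedAddCommGroup H] [InnerProductSpace ℂ H] [CompleteSpace H]
    {ι : 𝓚 →L[ℂ] H} {lam : ℕ → ℝ} {φ : ℕ → H}
    (h : IsEigensystem (ι ∘L ContinuousLinearMap.adjoint ι) lam φ) {ℓ : ℕ}
    (hℓ : ∀ i < ℓ, 0 < lam i) (Z : H) :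
    target ι lam φ ℓ Z ∈ hypothesisSpace ι lam φ ℓ ∧
      ∀ g ∈ hypothesisSpace ι lam φ ℓ, g ≠ target ι lam φ ℓ Z →
        ‖ι (target ι lam φ ℓ Z) - Z‖ ^ 2 < ‖ι g - Z‖ ^ 2 := by
  have hmem : target ι lam φ ℓ Z ∈ hypothesisSpace ι lam φ ℓ :=
    Submodule.sum_mem _ fun i hi => Submodule.smul_mem _ _
      (Submodule.subset_span ⟨i, Finset.mem_range.1 hi, rfl⟩)
  refine ⟨hmem, fun g hg hne => ?_⟩
  have hs : ∀ i < ℓ, (Real.sqrt (lam i) : ℂ) ≠ 0 := fun i hi => by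
    exact_mod_cast (Real.sqrt_pos.2 (hℓ i hi)).ne'
  have hsq : ∀ i < ℓ, (lam i : ℂ) = (Real.sqrt (lam i) : ℂ) * (Real.sqrt (lam i) : ℂ) :=
    fun i hi => by exact_mod_cast (Real.mul_self_sqrt (hℓ i hi).le).symm
  have hψ : ∀ i < ℓ, ι (psi ι lam φ i) = (Real.sqrt (lam i) : ℂ) • φ i := by
    intro i hi
    have := h.eigen i (hℓ i hi)
    simp only [ContinuousLinearMap.comp_apply] at this
    rw [psi, map_smul, this, smul_smul, hsq i hi, inv_mul_cancel_left₀ (hs i hi)]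
  have hort : ∀ i < ℓ, ∀ j < ℓ, ⟪φ i, φ j⟫_ℂ = if i = j then 1 else 0 := by
    intro i hi j hj
    have := orthonormal_iff_ite.1 h.orthonormal ⟨i, hℓ i hi⟩ ⟨j, hℓ j hj⟩
    simpa using this
  have hT : ι (target ι lam φ ℓ Z) = ∑ i ∈ Finset.range ℓ, ⟪φ i, Z⟫_ℂ • φ i := by
    rw [target, map_sum]
    refine Finset.sum_congr rfl fun i hi => ?_
    have hi := Finset.mem_range.1 hi
    rw [map_smul, hψ i hi, smul_smul, div_mul_cancel₀ _ (hs i hi)]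
  have hperp : ∀ i < ℓ, ⟪φ i, ι (target ι lam φ ℓ Z) - Z⟫_ℂ = 0 := by
    intro i hi
    rw [inner_sub_right, hT, inner_sum, Finset.sum_congr rfl (g := fun j =>
      if i = j then ⟪φ j, Z⟫_ℂ else 0)]
    · simp [hi]
    · intro j hj
      rw [inner_smul_right, hort i hi j (Finset.mem_range.1 hj)]
      simp
  have hperp' : ∀ d ∈ hypothesisSpace ι lam φ ℓ,
      ⟪ι d, ι (target ι lam φ ℓ Z) - Z⟫_ℂ = 0 := by
    intro d hd
    induction hd using Submodule.span_induction with
    | mem x hx =>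
      obtain ⟨i, hi, rfl⟩ := hx
      rw [hψ i hi, inner_smul_left, hperp i hi, mul_zero]
    | zero => simp
    | add x y _ _ hx hy => rw [map_add, inner_add_left, hx, hy, add_zero]
    | smul a x _ hx => rw [map_smul, inner_smul_left, hx, mul_zero]
  have hd : g - target ι lam φ ℓ Z ∈ hypothesisSpace ι lam φ ℓ := Submodule.sub_mem _ hg hmem
  have hinj : ι (g - target ι lam φ ℓ Z) ≠ 0 := by
    intro h0
    apply hne
    rw [← sub_eq_zero]
    have : ∀ e ∈ hypothesisSpace ι lam φ ℓ, ⟪e, g - target ι lam φ ℓ Z⟫_ℂ = 0 := by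
      intro e he
      induction he using Submodule.span_induction with
      | mem x hx =>
        obtain ⟨i, hi, rfl⟩ := hx
        rw [psi, inner_smul_left, ContinuousLinearMap.adjoint_inner_left, h0, inner_zero_right,
          mul_zero]
      | zero => simp
      | add x y _ _ hx hy => rw [inner_add_left, hx, hy, add_zero]
      | smul a x _ hx => rw [inner_smul_left, hx, mul_zero]
    exact inner_self_eq_zero.1 (this _ hd)
  have hsplit : ι g - Z = ι (g - target ι lam φ ℓ Z) + (ι (target ι lam φ ℓ Z) - Z) := by
    rw [map_sub]; abel
  have hpyth := norm_add_sq_eq_norm_sq_add_norm_sq_of_inner_eq_zero _ _ (hperp' _ hd)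
  rw [hsplit, sq, sq, hpyth]
  have := norm_pos_iff.2 hinj
  nlinarith

/-! ### Sampling along an orbit -/

/-- The uniform probability measure on `n` sample indices; `L²` of it is `ℂⁿ` with the normalized
dot product. -/
def indexMeasure (n : ℕ) : Measure (Fin n) := (n : ℝ≥0∞)⁻¹ • Measure.count

/-- The empirical measure `(1/n) ∑_{j < n} δ_{p j}` of a sequence of points `p`, as the law of
`p` under the uniform measure on the indices (see `empMeasure_eq_sum_dirac`). -/
def empMeasure {S : Type*} [MeasurableSpace S] (p : ℕ → S) (n : ℕ) : Measure S :=
  (indexMeasure n).map fun j : Fin n => p j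

theorem empMeasure_eq_sum_dirac {S : Type*} [MeasurableSpace S] (p : ℕ → S) (n : ℕ) :
    empMeasure p n = (n : ℝ≥0∞)⁻¹ • ∑ j ∈ Finset.range n, Measure.dirac (p j) := by
  have hm : Measurable fun j : Fin n => p j := Measurable.of_discrete
  ext s hs
  rw [empMeasure, indexMeasure, Measure.map_smul, Measure.smul_apply, Measure.smul_apply,
    Measure.map_apply hm hs, Measure.count_apply (hm hs), Measure.finsetSum_apply,
    ← Fin.sum_univ_eq_sum_range (fun j => Measure.dirac (p j) s) n]
  congr 1
  rw [← MeasureTheory.lintegral_indicator_one (hm hs) |>.trans (Measure.count_apply (hm hs)),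
    MeasureTheory.lintegral_count, tsum_fintype]
  refine Finset.sum_congr rfl fun j _ => ?_
  rw [Measure.dirac_apply' _ hs]
  rfl

/-- The sampled orbit; index `j` is the `(j+1)`-st sample. -/
def orbit {Ω : Type*} (Φ : ℝ≥0 → Ω → Ω) (Δt : ℝ≥0) (ω₁ : Ω) (j : ℕ) : Ω := Φ (j * Δt) ω₁

/-- The analog vector `(y_{1+q}, …, y_n, 0, …, 0) ∈ ℂⁿ`: the observations `y` shifted by `q`
steps. -/
def analogVec (y : ℕ → ℂ) (q n : ℕ) (j : Fin n) : ℂ := if (j : ℕ) + q < n then y (j + q) else 0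

/-- The empirical regression function `Z_{τ,n} ∈ L²(μ_{X,n})`: the regression function of the
analog vector given the covariate data `x`. -/
def empRegression {𝒳 : Type*} [MeasurableSpace 𝒳] (x : ℕ → 𝒳) (y : ℕ → ℂ) (q n : ℕ) :
    Lp ℂ 2 (empMeasure x n) :=
  regression (indexMeasure n) (X := fun j : Fin n => x j) Measurable.of_discrete (analogVec y q n)

/-- The ideal target function `f_{τ,ℓ} = T_ℓ Z_τ ∈ 𝓚` for the response `g = U^τ Y`. -/
def idealTarget {Ω 𝒳 : Type*} [MeasurableSpace Ω] [MeasurableSpace 𝒳] (μ : Measure Ω)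
    {X : Ω → 𝒳} (hX : Measurable X) (𝓚 : Type*) [NormedAddCommGroup 𝓚] [InnerProductSpace ℂ 𝓚]
    [CompleteSpace 𝓚] [RKHS ℂ 𝓚 𝒳 ℂ] (lam : ℕ → ℝ) (φ : ℕ → Lp ℂ 2 (μ.map X)) (g : Ω → ℂ)
    (ℓ : ℕ) : 𝓚 :=
  target (incl 𝓚 (μ.map X)) lam φ ℓ (regression μ hX g)

/-- The empirical target function `f_{τ,ℓ,n} = T_{ℓ,n} Z_{τ,n} ∈ 𝓚ₙ`, `τ = q Δt`, for the
covariate data `x` and the response data `y`. -/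
def empTarget {𝒳 : Type*} [MeasurableSpace 𝒳] (x : ℕ → 𝒳) (y : ℕ → ℂ) (n : ℕ) (𝓚ₙ : Type*)
    [NormedAddCommGroup 𝓚ₙ] [InnerProductSpace ℂ 𝓚ₙ] [CompleteSpace 𝓚ₙ] [RKHS ℂ 𝓚ₙ 𝒳 ℂ]
    (lam : ℕ → ℝ) (φ : ℕ → Lp ℂ 2 (empMeasure x n)) (q ℓ : ℕ) : 𝓚ₙ :=
  target (incl 𝓚ₙ (empMeasure x n)) lam φ ℓ (empRegression x y q n)

end

end KAF

/-!
With `T = ι* ι` on `𝓚`, the target function is `f_{τ,ℓ} = h(T) ι* Z_τ` for every continuous `h`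
equal to `t⁻¹` at `λ₁, …, λ_ℓ` and to `0` on `[0, λ_{ℓ+1}]`; the spectral gap provides such an `h`,
and it also serves the empirical operator `Tₙ` as soon as `λ_{i,n}` is close to `λ_i` for
`i ≤ ℓ + 1`. This removes the eigenfunctions, and their choice, from the convergence problem.

The functions `(x, x') ↦ ⟨k_x, f(Tₙ) k_{x'}⟩` converge uniformly on `U × U` for every continuous
`f`: for monomials they are iterated integrals of the kernels against the weakly convergent
sampling measures, and Weierstrass approximation does the rest. The integral of
`⟨k_x, h(T) k_x⟩` is the trace of `h(T) T`, that is `∑ h(λ_i) λ_i`, so with `h` a cutoff of `t⁻¹`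
it counts eigenvalues, which gives `λ_{i,n} → λ_i`. Finally `(h(Tₙ) ιₙ* Z_{τ,n})(x)` is the average
of `⟨k_x, h(Tₙ) k_{x_j}⟩ y_{j+q}` over the samples; the zero padding of the response amounts to
averaging over the first `n - q` of them.

For the limit `ℓ → ∞`, strict positivity makes the eigenfunctions a Hilbert basis, and partial
orthogonal expansions converge uniformly on compact sets of regression functions. That `μ` is
carried by its support, although `Ω` need not be separable, holds because `μ` is a weak limit of
measures on the countable orbit.
-/

namespace KAF

noncomputable section

open ContinuousLinearMap (adjoint)

/-! ### Functional calculus of self-adjoint operators -/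

/-- Weierstrass approximation as an induction principle. -/
theorem continuous_induction {P : (ℝ → ℝ) → Prop} (M : ℝ)
    (const : ∀ a : ℝ, P fun _ => a)
    (add : ∀ f g, Continuous f → Continuous g → P f → P g → P fun t => f t + g t)
    (id_mul : ∀ f, Continuous f → P f → P fun t => t * f t)
    (approx : ∀ f, Continuous f →
      (∀ ε > 0, ∃ g, Continuous g ∧ P g ∧ ∀ t ∈ Icc (-M) M, ‖f t - g t‖ ≤ ε) → P f)
    {f : ℝ → ℝ} (hf : Continuous f) : P f := by
  have polynomial : ∀ p : Polynomial ℝ, P fun t => p.eval t := fun p => by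
    induction p using Polynomial.induction_on with
    | C a => simpa only [Polynomial.eval_C] using const a
    | add p q hp hq =>
      simpa only [Polynomial.eval_add] using add _ _ p.continuous q.continuous hp hq
    | monomial n a h =>
      convert id_mul _ (Polynomial.continuous _) h using 2 with t
      simp only [Polynomial.eval_mul, Polynomial.eval_C, Polynomial.eval_pow, Polynomial.eval_X]
      ring
  refine approx f hf fun ε hε => ?_
  obtain ⟨p, hp⟩ := exists_polynomial_near_of_continuousOn (-M) M f hf.continuousOn ε hε
  refine ⟨fun t => p.eval t, p.continuous, polynomial p, fun t ht => ?_⟩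
  rw [norm_sub_rev]
  exact (hp t ht).le

section Cfc

variable {E : Type*} [NormedAddCommGroup E] [InnerProductSpace ℂ E] [CompleteSpace E]
  {T : E →L[ℂ] E} {f g : ℝ → ℝ}

theorem norm_cfc_sub_cfc_le {M ε : ℝ} (hT : IsSelfAdjoint T) (hf : Continuous f)
    (hg : Continuous g) (hM : ‖T‖ ≤ M) (hε : 0 ≤ ε)
    (h : ∀ t ∈ Icc (-M) M, ‖f t - g t‖ ≤ ε) : ‖cfc f T - cfc g T‖ ≤ ε := by
  rw [← cfc_sub f g T hf.continuousOn hg.continuousOn]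
  refine norm_cfc_le hε fun t ht => h t ?_
  exact abs_le.1 ((IsometricContinuousFunctionalCalculus.norm_spectrum_le T ht hT).trans hM)

theorem cfc_id_mul_apply (hT : IsSelfAdjoint T) (hf : Continuous f) (v : E) :
    cfc (fun t => t * f t) T v = T (cfc f T v) := by
  rw [cfc_mul (fun t => t) f T continuousOn_id hf.continuousOn, cfc_id' ℝ T,
    mul_apply_eq_comp]

theorem cfc_const_apply (hT : IsSelfAdjoint T) (a : ℝ) (v : E) :
    cfc (fun _ => a) T v = (a : ℂ) • v := by
  rw [cfc_const a T]
  simp [Algebra.algebraMap_eq_smul_one]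

theorem cfc_apply_of_apply_eq_smul {r : ℝ} {v : E} (hT : IsSelfAdjoint T)
    (hv : T v = (r : ℂ) • v) (hf : Continuous f) : cfc f T v = (f r : ℂ) • v := by
  refine continuous_induction (P := fun f => cfc f T v = (f r : ℂ) • v) (max ‖T‖ |r|)
    (fun a => cfc_const_apply hT a v) ?_ ?_ ?_ hf
  · intro f g hf hg ihf ihg
    rw [cfc_add T f g hf.continuousOn hg.continuousOn, add_apply, ihf, ihg,
      ← add_smul, Complex.ofReal_add]
  · intro f hf ih
    rw [cfc_id_mul_apply hT hf, ih, map_smul, hv, smul_smul, mul_comm, Complex.ofReal_mul]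
  · intro f hf happrox
    rw [← sub_eq_zero, ← norm_le_zero_iff]
    refine le_of_forall_pos_le_add fun δ hδ => ?_
    obtain ⟨g, hg, hgv, hfg⟩ := happrox (δ / (2 * ‖v‖ + 1)) (by positivity)
    have hsplit : cfc f T v - (f r : ℂ) • v
        = (cfc f T - cfc g T) v + ((g r - f r : ℝ) : ℂ) • v := by
      rw [sub_apply, hgv, Complex.ofReal_sub, sub_smul]
      abel
    have hop : ‖cfc f T - cfc g T‖ ≤ δ / (2 * ‖v‖ + 1) :=
      norm_cfc_sub_cfc_le hT hf hg (le_max_left _ _) (by positivity) hfg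
    have hval : ‖((g r - f r : ℝ) : ℂ)‖ ≤ δ / (2 * ‖v‖ + 1) := by
      rw [Complex.norm_real, norm_sub_rev]
      exact hfg r (abs_le.1 (le_max_right _ _))
    calc ‖cfc f T v - (f r : ℂ) • v‖
        ≤ δ / (2 * ‖v‖ + 1) * ‖v‖ + δ / (2 * ‖v‖ + 1) * ‖v‖ := by
          rw [hsplit]
          refine norm_add_le_of_le (ContinuousLinearMap.le_of_opNorm_le _ hop v) ?_
          rw [norm_smul]
          gcongr
      _ = δ * (2 * ‖v‖ / (2 * ‖v‖ + 1)) := by ring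
      _ ≤ 0 + δ := by
          rw [zero_add]
          refine mul_le_of_le_one_right hδ.le ((div_le_one (by positivity)).2 (by linarith))

end Cfc

theorem tendstoUniformlyOn_of_isCompact_of_tendsto {𝕜 E F : Type*}
    [NontriviallyNormedField 𝕜] [NormedAddCommGroup E] [NormedSpace 𝕜 E] [CompleteSpace E]
    [NormedAddCommGroup F] [NormedSpace 𝕜 F] {A : ℕ → E →L[𝕜] F} {B : E → F}
    (hA : ∀ v, Tendsto (fun n => A n v) atTop (𝓝 (B v))) {K : Set E} (hK : IsCompact K) :
    TendstoUniformlyOn (fun n v => A n v) B atTop K := by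
  have hbdd : ∃ C, ∀ n, ‖A n‖ ≤ C := banach_steinhaus fun v => by
    obtain ⟨C, hC⟩ := (hA v).norm.bddAbove_range
    exact ⟨C, fun n => hC ⟨n, rfl⟩⟩
  have hequi : Equicontinuous fun n v => A n v :=
    ((NormedSpace.equicontinuous_TFAE A).out 5 1).1 hbdd
  have hpi : Tendsto (fun n v => A n v) atTop (𝓝 B) := tendsto_pi_nhds.2 hA
  refine UniformOnFun.tendsto_iff_tendstoUniformlyOn.1
    ((EquicontinuousOn.tendsto_uniformOnFun_iff_pi' (𝔖 := {K}) (by simpa using hK)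
      (fun K _ => hequi.equicontinuousOn K) atTop B).2 ?_) K rfl
  exact (Pi.continuous_domRestrict _).continuousAt.tendsto.comp hpi

/-! ### Expansions in orthonormal eigenvectors -/

theorem hasSum_inner_smul_of_orthonormal {𝕜 E I : Type*} [RCLike 𝕜] [NormedAddCommGroup E]
    [InnerProductSpace 𝕜 E] [CompleteSpace E] {b : I → E} (hb : Orthonormal 𝕜 b) {v : E}
    (hv : ∀ u, (∀ i, ⟪b i, u⟫_𝕜 = 0) → ⟪u, v⟫_𝕜 = 0) :
    HasSum (fun i => ⟪b i, v⟫_𝕜 • b i) v := by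
  obtain ⟨w, B, hsub, hB⟩ := hb.toSubtypeRange.exists_hilbertBasis_extension
  let j : I → w := fun i => ⟨b i, hsub ⟨i, rfl⟩⟩
  have hj : Function.Injective j := fun i i' h => hb.linearIndependent.injective
    (congrArg Subtype.val h)
  have hBj : ∀ i, B (j i) = b i := fun i => by rw [hB]
  have hout : ∀ y ∉ range j, B.repr v y • B y = 0 := fun y hy => by
    have horth : ⟪B y, v⟫_𝕜 = 0 := hv _ fun i => by
      rw [← hBj]
      exact B.orthonormal.inner_eq_zero fun h => hy ⟨i, h⟩
    rw [B.repr_apply_apply, horth, zero_smul]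
  refine ((hj.hasSum_iff hout).2 (B.hasSum_repr v)).congr_fun fun i => ?_
  rw [Function.comp_apply, B.repr_apply_apply, hBj]

section Eigensystem

variable {E : Type*} [NormedAddCommGroup E] [InnerProductSpace ℂ E] [CompleteSpace E]
  {T : E →L[ℂ] E} {lam : ℕ → ℝ} {ψ : ℕ → E}

theorem IsEigensystem.hasSum_inner_smul (h : IsEigensystem T lam ψ) {v : E}
    (hv : ∀ u, T u = 0 → ⟪u, v⟫_ℂ = 0) :
    HasSum (fun i => if 0 < lam i then ⟪ψ i, v⟫_ℂ • ψ i else 0) v := by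
  have hsub := hasSum_inner_smul_of_orthonormal h.orthonormal (v := v) fun u hu =>
    hv u (h.complete u fun i hi => hu ⟨i, hi⟩)
  exact (hasSum_subtype_iff_indicator (s := {i | 0 < lam i})
    (f := fun i => ⟪ψ i, v⟫_ℂ • ψ i)).1 hsub

theorem IsEigensystem.hasSum_cfc_apply (h : IsEigensystem T lam ψ) (hT : IsSelfAdjoint T)
    {f : ℝ → ℝ} (hf : Continuous f) (hf0 : f 0 = 0) (v : E) :
    HasSum (fun i => ((f (lam i) : ℂ) * ⟪ψ i, v⟫_ℂ) • ψ i) (cfc f T v) := by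
  have symm : ∀ u, ⟪u, cfc f T v⟫_ℂ = ⟪cfc f T u, v⟫_ℂ := fun u =>
    ((IsSelfAdjoint.cfc (f := f) (a := T)).isSymmetric u v).symm
  refine (h.hasSum_inner_smul fun u hu => ?_).congr_fun fun i => ?_
  · rw [symm, cfc_apply_of_apply_eq_smul hT (r := 0) (by simpa using hu) hf, hf0]
    simp
  · split_ifs with hi
    · rw [symm, cfc_apply_of_apply_eq_smul hT (h.eigen i hi) hf, inner_smul_left,
        Complex.conj_ofReal]
    · rw [le_antisymm (not_lt.1 hi) (h.nonneg i), hf0]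
      simp

end Eigensystem

section Target

variable {𝓚 H : Type*} [NormedAddCommGroup 𝓚] [InnerProductSpace ℂ 𝓚] [CompleteSpace 𝓚]
  [NormedAddCommGroup H] [InnerProductSpace ℂ H] [CompleteSpace H]
  {ι : 𝓚 →L[ℂ] H} {lam : ℕ → ℝ} {φ : ℕ → H}

theorem isSelfAdjoint_adjoint_comp_self (ι : 𝓚 →L[ℂ] H) : IsSelfAdjoint (adjoint ι ∘L ι) :=
  (ContinuousLinearMap.isPositive_adjoint_comp_self ι).isSelfAdjoint

theorem ofReal_eq_sqrt_mul_sqrt {r : ℝ} (hr : 0 ≤ r) : (r : ℂ) = (√r : ℂ) * (√r : ℂ) := by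
  rw [← Complex.ofReal_mul, Real.mul_self_sqrt hr]

theorem ofReal_sqrt_ne_zero {r : ℝ} (hr : 0 < r) : (√r : ℂ) ≠ 0 :=
  Complex.ofReal_ne_zero.2 (Real.sqrt_ne_zero'.2 hr)

theorem inner_psi (i : ℕ) (f : 𝓚) :
    ⟪psi ι lam φ i, f⟫_ℂ = (√(lam i) : ℂ)⁻¹ * ⟪φ i, ι f⟫_ℂ := by
  rw [psi, inner_smul_left, ContinuousLinearMap.adjoint_inner_left, ← Complex.ofReal_inv,
    Complex.conj_ofReal]

theorem IsEigensystem.apply_psi (h : IsEigensystem (ι ∘L adjoint ι) lam φ)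
    {i : ℕ} (hi : 0 < lam i) : ι (psi ι lam φ i) = (√(lam i) : ℂ) • φ i := by
  have heigen : ι (adjoint ι (φ i)) = (lam i : ℂ) • φ i := h.eigen i hi
  rw [psi, map_smul, heigen, smul_smul, ofReal_eq_sqrt_mul_sqrt hi.le,
    inv_mul_cancel_left₀ (ofReal_sqrt_ne_zero hi)]

theorem IsEigensystem.adjoint_comp_self (h : IsEigensystem (ι ∘L adjoint ι) lam φ) :
    IsEigensystem (adjoint ι ∘L ι) lam (psi ι lam φ) where
  antitone := h.antitone
  nonneg := h.nonneg
  orthonormal := by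
    rw [orthonormal_iff_ite]
    intro i j
    rw [inner_psi, h.apply_psi j.2, inner_smul_right, orthonormal_iff_ite.1 h.orthonormal i j]
    split_ifs with hij
    · rw [hij, mul_one, inv_mul_cancel₀ (ofReal_sqrt_ne_zero j.2)]
    · simp
  eigen i hi := by
    rw [ContinuousLinearMap.comp_apply, h.apply_psi hi, map_smul, psi, smul_smul,
      ofReal_eq_sqrt_mul_sqrt hi.le, mul_inv_cancel_right₀ (ofReal_sqrt_ne_zero hi)]
  complete f hf := by
    have hker : (ι ∘L adjoint ι) (ι f) = 0 := h.complete _ fun i hi => by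
      simpa [inner_psi, ofReal_sqrt_ne_zero hi] using hf i hi
    have hmem : ι f ∈ (ι ∘L adjoint ι).ker := hker
    rwa [ContinuousLinearMap.ker_self_comp_adjoint] at hmem

theorem IsEigensystem.target_eq_cfc (h : IsEigensystem (ι ∘L adjoint ι) lam φ) {ℓ : ℕ}
    (hℓ : ∀ i < ℓ, 0 < lam i) {f : ℝ → ℝ} (hf : Continuous f) (hf0 : f 0 = 0)
    (hinv : ∀ i < ℓ, f (lam i) = (lam i)⁻¹) (hzero : ∀ i, ℓ ≤ i → f (lam i) = 0) (Z : H) :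
    target ι lam φ ℓ Z = cfc f (adjoint ι ∘L ι) (adjoint ι Z) := by
  refine HasSum.unique ?_
    (h.adjoint_comp_self.hasSum_cfc_apply (isSelfAdjoint_adjoint_comp_self ι) hf hf0 (adjoint ι Z))
  have hterm : ∀ i < ℓ, (⟪φ i, Z⟫_ℂ / (√(lam i) : ℂ)) • psi ι lam φ i =
      ((f (lam i) : ℂ) * ⟪psi ι lam φ i, adjoint ι Z⟫_ℂ) • psi ι lam φ i := by
    intro i hi
    have hsqrt := ofReal_sqrt_ne_zero (hℓ i hi)
    rw [hinv i hi, ContinuousLinearMap.adjoint_inner_right, h.apply_psi (hℓ i hi),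
      inner_smul_left, Complex.conj_ofReal, Complex.ofReal_inv,
      ofReal_eq_sqrt_mul_sqrt (hℓ i hi).le]
    congr 1
    field_simp
  rw [target, Finset.sum_congr rfl fun i hi => hterm i (Finset.mem_range.1 hi)]
  refine hasSum_sum_of_ne_finset_zero fun i hi => ?_
  rw [hzero i (not_lt.1 (mt Finset.mem_range.2 hi)), Complex.ofReal_zero, zero_mul, zero_smul]

theorem IsEigensystem.apply_target (h : IsEigensystem (ι ∘L adjoint ι) lam φ) (ℓ : ℕ) (Z : H) :
    ι (target ι lam φ ℓ Z) =
      ∑ i ∈ Finset.range ℓ, if 0 < lam i then ⟪φ i, Z⟫_ℂ • φ i else 0 := by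
  rw [target, map_sum]
  refine Finset.sum_congr rfl fun i _ => ?_
  split_ifs with hi
  · rw [map_smul, h.apply_psi hi, smul_smul, div_mul_cancel₀ _ (ofReal_sqrt_ne_zero hi)]
  · rw [le_antisymm (not_lt.1 hi) (h.nonneg i)]
    simp

theorem IsEigensystem.tendsto_apply_target (h : IsEigensystem (ι ∘L adjoint ι) lam φ)
    (hker : ∀ f, (ι ∘L adjoint ι) f = 0 → f = 0) (Z : H) :
    Tendsto (fun ℓ => ι (target ι lam φ ℓ Z)) atTop (𝓝 Z) := by
  simp only [h.apply_target]
  refine (h.hasSum_inner_smul fun u hu => ?_).tendsto_sum_nat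
  rw [hker u hu, inner_zero_left]

theorem IsEigensystem.tendstoUniformlyOn_apply_target (h : IsEigensystem (ι ∘L adjoint ι) lam φ)
    (hker : ∀ f, (ι ∘L adjoint ι) f = 0 → f = 0) {K : Set H} (hK : IsCompact K) :
    TendstoUniformlyOn (fun ℓ Z => ι (target ι lam φ ℓ Z)) id atTop K := by
  let A : ℕ → H →L[ℂ] H := fun ℓ => ∑ i ∈ Finset.range ℓ,
    if 0 < lam i then InnerProductSpace.rankOne ℂ (φ i) (φ i) else 0
  have hA : ∀ ℓ Z, A ℓ Z = ι (target ι lam φ ℓ Z) := fun ℓ Z => by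
    rw [h.apply_target, sum_apply]
    refine Finset.sum_congr rfl fun i _ => ?_
    split_ifs <;> rfl
  simp only [← hA]
  refine tendstoUniformlyOn_of_isCompact_of_tendsto (fun Z => ?_) hK
  simpa only [hA, id] using h.tendsto_apply_target hker Z

end Target

/-! ### Kernels of functions of the covariance operator -/

section KernelSection

variable {𝒳 𝓚 : Type*} [NormedAddCommGroup 𝓚] [InnerProductSpace ℂ 𝓚] [CompleteSpace 𝓚]
  [RKHS ℂ 𝓚 𝒳 ℂ]

variable (𝓚) in
/-- The section `k_x ∈ 𝓚` of the kernel of a complex-valued RKHS, which represents the evaluation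
at `x`. -/
def kernelSection (x : 𝒳) : 𝓚 := RKHS.kerFun 𝓚 x (1 : ℂ)

theorem inner_kernelSection (x : 𝒳) (f : 𝓚) : ⟪kernelSection 𝓚 x, f⟫_ℂ = f x := by
  rw [kernelSection, RKHS.kerFun_inner]
  simp

theorem norm_kernelSection_sq (x : 𝒳) : ‖kernelSection 𝓚 x‖ ^ 2 = ‖scalarKernel 𝓚 x x‖ := by
  rw [← inner_kerFun_eq_scalarKernel, ← kernelSection, inner_self_eq_norm_sq_to_K, norm_pow,
    RCLike.norm_ofReal, abs_norm]

theorem norm_kernelSection_le {x : 𝒳} {B : ℝ} (hB : ‖scalarKernel 𝓚 x x‖ ≤ B) :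
    ‖kernelSection 𝓚 x‖ ≤ √B :=
  Real.le_sqrt_of_sq_le (by rwa [norm_kernelSection_sq])

theorem continuous_kernelSection [TopologicalSpace 𝒳]
    (hk : Continuous fun p : 𝒳 × 𝒳 => scalarKernel 𝓚 p.1 p.2) :
    Continuous fun x : 𝒳 => kernelSection 𝓚 x := by
  refine continuous_iff_continuousAt.2 fun x => tendsto_iff_norm_sub_tendsto_zero.2 ?_
  have hnorm : ∀ y, ‖kernelSection 𝓚 y - kernelSection 𝓚 x‖ = √(scalarKernel 𝓚 y y
      - scalarKernel 𝓚 y x - scalarKernel 𝓚 x y + scalarKernel 𝓚 x x).re := fun y => by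
    simp only [← inner_kerFun_eq_scalarKernel]
    rw [← inner_sub_sub_self, norm_eq_sqrt_re_inner (𝕜 := ℂ)]
    rfl
  have hcont : Continuous fun y => √(scalarKernel 𝓚 y y
      - scalarKernel 𝓚 y x - scalarKernel 𝓚 x y + scalarKernel 𝓚 x x).re := by
    fun_prop
  simpa [hnorm] using hcont.tendsto x

end KernelSection

theorem isFiniteMeasure_of_measure_univ_le_one {S : Type*} [MeasurableSpace S] {ν : Measure S}
    (hν : ν univ ≤ 1) : IsFiniteMeasure ν :=
  ⟨hν.trans_lt ENNReal.one_lt_top⟩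

section CfcKernel

variable {𝒳 𝓚 : Type*} [MeasurableSpace 𝒳] [NormedAddCommGroup 𝓚] [InnerProductSpace ℂ 𝓚]
  [CompleteSpace 𝓚] [RKHS ℂ 𝓚 𝒳 ℂ] {ρ : Measure 𝒳} {f g : ℝ → ℝ}

variable (𝓚 ρ) in
/-- The covariance operator `ι* ι` of an RKHS with respect to the measure `ρ`; it has the same
positive eigenvalues as `kernelOp 𝓚 ρ`, but acts on the RKHS. -/
def covOp : 𝓚 →L[ℂ] 𝓚 := adjoint (incl 𝓚 ρ) ∘L incl 𝓚 ρ

variable (𝓚 ρ) in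
/-- The kernel `⟨k_x, f(ι* ι) k_x'⟩` of a function `f` of the covariance operator, given by the
continuous functional calculus. -/
def cfcKernel (f : ℝ → ℝ) (x x' : 𝒳) : ℂ :=
  ⟪kernelSection 𝓚 x, cfc f (covOp 𝓚 ρ) (kernelSection 𝓚 x')⟫_ℂ

theorem isSelfAdjoint_covOp : IsSelfAdjoint (covOp 𝓚 ρ) :=
  isSelfAdjoint_adjoint_comp_self _

theorem continuous_cfcKernel [TopologicalSpace 𝒳]
    (hk : Continuous fun p : 𝒳 × 𝒳 => scalarKernel 𝓚 p.1 p.2) (f : ℝ → ℝ) :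
    Continuous fun p : 𝒳 × 𝒳 => cfcKernel 𝓚 ρ f p.1 p.2 :=
  ((continuous_kernelSection hk).comp continuous_fst).inner
    ((ContinuousLinearMap.continuous _).comp ((continuous_kernelSection hk).comp continuous_snd))

theorem cfcKernel_const (a : ℝ) (x x' : 𝒳) :
    cfcKernel 𝓚 ρ (fun _ => a) x x' = a * scalarKernel 𝓚 x x' := by
  rw [cfcKernel, cfc_const_apply isSelfAdjoint_covOp, inner_smul_right,
    ← inner_kerFun_eq_scalarKernel]
  rfl

theorem cfcKernel_add (hf : Continuous f) (hg : Continuous g) (x x' : 𝒳) :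
    cfcKernel 𝓚 ρ (fun t => f t + g t) x x' = cfcKernel 𝓚 ρ f x x' + cfcKernel 𝓚 ρ g x x' := by
  rw [cfcKernel, cfc_add _ f g hf.continuousOn hg.continuousOn, add_apply, inner_add_right]
  rfl

theorem inner_incl_incl (hmem : ∀ u : 𝓚, MemLp (⇑u) 2 ρ) (u v : 𝓚) :
    ⟪incl 𝓚 ρ u, incl 𝓚 ρ v⟫_ℂ = ∫ x, v x * starRingEnd ℂ (u x) ∂ρ := by
  rw [L2.inner_def]
  refine integral_congr_ae ?_
  filter_upwards [coeFn_incl hmem u, coeFn_incl hmem v] with x hu hv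
  rw [hu, hv]
  rfl

theorem cfcKernel_id_mul (hmem : ∀ u : 𝓚, MemLp (⇑u) 2 ρ) (hf : Continuous f) (x x' : 𝒳) :
    cfcKernel 𝓚 ρ (fun t => t * f t) x x'
      = ∫ y, scalarKernel 𝓚 x y * cfcKernel 𝓚 ρ f y x' ∂ρ := by
  rw [cfcKernel, cfc_id_mul_apply isSelfAdjoint_covOp hf, covOp, ContinuousLinearMap.comp_apply,
    ContinuousLinearMap.adjoint_inner_right, inner_incl_incl hmem]
  refine integral_congr_ae (Eventually.of_forall fun y => ?_)
  beta_reduce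
  rw [mul_comm, ← inner_kernelSection y (kernelSection 𝓚 x), inner_conj_symm]
  exact congrArg₂ _ (inner_kerFun_eq_scalarKernel 𝓚 x y) (inner_kernelSection y _).symm

theorem norm_covOp_le (hmem : ∀ u : 𝓚, MemLp (⇑u) 2 ρ) (hρ : ρ univ ≤ 1) {U : Set 𝒳}
    (hρU : ∀ᵐ x ∂ρ, x ∈ U) {B : ℝ} (hB0 : 0 ≤ B) (hB : ∀ x ∈ U, ‖scalarKernel 𝓚 x x‖ ≤ B) :
    ‖covOp 𝓚 ρ‖ ≤ B := by
  have hincl : ‖incl 𝓚 ρ‖ ≤ √B := by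
    refine ContinuousLinearMap.opNorm_le_bound _ (Real.sqrt_nonneg B) fun u => ?_
    have hbound : ∀ᵐ x ∂ρ, ‖incl 𝓚 ρ u x‖ ≤ √B * ‖u‖ := by
      filter_upwards [hρU, coeFn_incl hmem u] with x hx hu
      rw [hu, ← inner_kernelSection]
      exact (norm_inner_le_norm _ _).trans
        (mul_le_mul_of_nonneg_right (norm_kernelSection_le (hB x hx)) (norm_nonneg u))
    have := isFiniteMeasure_of_measure_univ_le_one hρ
    refine (Lp.norm_le_of_ae_bound (by positivity) hbound).trans
      (mul_le_of_le_one_left (by positivity) ?_)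
    exact Real.rpow_le_one (measureUnivNNReal ρ).coe_nonneg
      (ENNReal.toReal_mono ENNReal.one_ne_top hρ) (by positivity)
  rw [covOp, ContinuousLinearMap.norm_adjoint_comp_self, ← sq]
  exact (Real.le_sqrt (norm_nonneg _) hB0).1 hincl

theorem norm_cfcKernel_sub_cfcKernel_le (hmem : ∀ u : 𝓚, MemLp (⇑u) 2 ρ) (hρ : ρ univ ≤ 1)
    {U : Set 𝒳} (hρU : ∀ᵐ x ∂ρ, x ∈ U) {B ε : ℝ} (hB0 : 0 ≤ B)
    (hB : ∀ x ∈ U, ‖scalarKernel 𝓚 x x‖ ≤ B) (hf : Continuous f) (hg : Continuous g)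
    (hε : 0 ≤ ε) (hfg : ∀ t ∈ Icc (-B) B, ‖f t - g t‖ ≤ ε) {x x' : 𝒳} (hx : x ∈ U)
    (hx' : x' ∈ U) : ‖cfcKernel 𝓚 ρ f x x' - cfcKernel 𝓚 ρ g x x'‖ ≤ ε * B := by
  have hop : ‖cfc f (covOp 𝓚 ρ) - cfc g (covOp 𝓚 ρ)‖ ≤ ε :=
    norm_cfc_sub_cfc_le isSelfAdjoint_covOp hf hg (norm_covOp_le hmem hρ hρU hB0 hB) hε hfg
  rw [cfcKernel, cfcKernel, ← inner_sub_right, ← sub_apply]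
  calc ‖⟪kernelSection 𝓚 x, (cfc f (covOp 𝓚 ρ) - cfc g (covOp 𝓚 ρ)) (kernelSection 𝓚 x')⟫_ℂ‖
      ≤ ‖kernelSection 𝓚 x‖ * (ε * ‖kernelSection 𝓚 x'‖) :=
        (norm_inner_le_norm _ _).trans (by
          gcongr
          exact ContinuousLinearMap.le_of_opNorm_le _ hop _)
    _ ≤ √B * (ε * √B) := by
        gcongr
        · exact norm_kernelSection_le (hB x hx)
        · exact norm_kernelSection_le (hB x' hx')
    _ = ε * B := by rw [mul_left_comm, Real.mul_self_sqrt hB0]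

/-! ### The trace formula -/

theorem integral_norm_sq_eq_norm_incl_sq (hmem : ∀ u : 𝓚, MemLp (⇑u) 2 ρ) (u : 𝓚) :
    ∫ x, ‖u x‖ ^ 2 ∂ρ = ‖incl 𝓚 ρ u‖ ^ 2 := by
  have hinner := inner_incl_incl hmem u u
  simp only [Complex.mul_conj', inner_self_eq_norm_sq_to_K] at hinner
  have hcast : ((‖incl 𝓚 ρ u‖ ^ 2 : ℝ) : ℂ) = ((∫ x, ‖u x‖ ^ 2 ∂ρ : ℝ) : ℂ) := by
    rw [← integral_complex_ofReal]
    push_cast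
    exact hinner
  exact (Complex.ofReal_inj.1 hcast).symm

variable {lam : ℕ → ℝ} {ψ : ℕ → 𝓚}

theorem IsEigensystem.integral_norm_sq (h : IsEigensystem (covOp 𝓚 ρ) lam ψ)
    (hmem : ∀ u : 𝓚, MemLp (⇑u) 2 ρ) {i : ℕ} (hi : 0 < lam i) :
    ∫ x, ‖ψ i x‖ ^ 2 ∂ρ = lam i := by
  have hnorm : ‖ψ i‖ = 1 := h.orthonormal.1 ⟨i, hi⟩
  have hinner : ⟪ψ i, covOp 𝓚 ρ (ψ i)⟫_ℂ = (lam i : ℂ) := by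
    rw [h.eigen i hi, inner_smul_right, inner_self_eq_norm_sq_to_K, hnorm]
    simp
  rw [integral_norm_sq_eq_norm_incl_sq hmem]
  rw [covOp, ContinuousLinearMap.comp_apply, ContinuousLinearMap.adjoint_inner_right,
    inner_self_eq_norm_sq_to_K] at hinner
  exact Complex.ofReal_inj.1 (by rw [← hinner, Complex.ofReal_pow]; rfl)

theorem IsEigensystem.summable_of_integrable (h : IsEigensystem (covOp 𝓚 ρ) lam ψ)
    (hmem : ∀ u : 𝓚, MemLp (⇑u) 2 ρ) (hint : Integrable (fun x => scalarKernel 𝓚 x x) ρ) :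
    Summable lam := by
  have hsub : Summable fun i : {i | 0 < lam i} => lam i := by
    refine summable_of_sum_le (c := ∫ x, ‖scalarKernel 𝓚 x x‖ ∂ρ) (fun i => h.nonneg i)
      fun s => ?_
    calc ∑ i ∈ s, lam i = ∫ x, ∑ i ∈ s, ‖ψ i x‖ ^ 2 ∂ρ := by
          rw [integral_finsetSum s (f := fun i x => ‖ψ i x‖ ^ 2) fun i _ =>
            (hmem (ψ i)).norm.integrable_sq]
          exact Finset.sum_congr rfl fun i _ => (h.integral_norm_sq hmem i.2).symm
      _ ≤ ∫ x, ‖scalarKernel 𝓚 x x‖ ∂ρ := by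
          refine integral_mono (integrable_finsetSum _ fun i _ => (hmem (ψ i)).norm.integrable_sq)
            hint.norm fun x => ?_
          simpa only [← norm_kernelSection_sq, ← inner_kernelSection, norm_inner_symm]
            using h.orthonormal.sum_inner_products_le (s := s) (kernelSection 𝓚 x)
  have hsupport : Function.support lam ⊆ {i | 0 < lam i} := fun i hi =>
    (h.nonneg i).lt_of_ne' hi
  exact (summable_subtype_iff_indicator.1 hsub).congr fun i =>
    congrFun (indicator_eq_self.2 hsupport) i

theorem IsEigensystem.hasSum_integral_cfcKernel (h : IsEigensystem (covOp 𝓚 ρ) lam ψ)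
    (hmem : ∀ u : 𝓚, MemLp (⇑u) 2 ρ) (hint : Integrable (fun x => scalarKernel 𝓚 x x) ρ)
    (hf : Continuous f) (hf0 : f 0 = 0) :
    HasSum (fun i => ((f (lam i) * lam i : ℝ) : ℂ)) (∫ x, cfcKernel 𝓚 ρ f x x ∂ρ) := by
  let F : ℕ → 𝒳 → ℂ := fun i x => ((f (lam i) * ‖ψ i x‖ ^ 2 : ℝ) : ℂ)
  have hF : ∀ x, HasSum (fun i => F i x) (cfcKernel 𝓚 ρ f x x) := fun x => by
    refine ((innerSL ℂ (kernelSection 𝓚 x)).hasSum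
      (h.hasSum_cfc_apply isSelfAdjoint_covOp hf hf0 (kernelSection 𝓚 x))).congr_fun fun i => ?_
    rw [innerSL_apply_apply, inner_smul_right, mul_assoc, ← inner_conj_symm, inner_kernelSection,
      Complex.conj_mul']
    simp [F]
  have hFint : ∀ i, Integrable (F i) ρ := fun i =>
    ((hmem (ψ i)).norm.integrable_sq.const_mul _).ofReal
  have hintegral : ∀ (c : ℝ → ℝ), c 0 = 0 → ∀ i,
      ∫ x, c (lam i) * ‖ψ i x‖ ^ 2 ∂ρ = c (lam i) * lam i := fun c hc i => by
    rw [integral_const_mul]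
    rcases (h.nonneg i).eq_or_lt with hi | hi
    · rw [← hi, hc, zero_mul, zero_mul]
    · rw [h.integral_norm_sq hmem hi]
  have hsum : Summable fun i => ∫ x, ‖F i x‖ ∂ρ := by
    obtain ⟨C, hC⟩ := isCompact_Icc.exists_bound_of_continuousOn
      (hf.continuousOn (s := Icc 0 (lam 0)))
    refine Summable.of_nonneg_of_le (fun i => integral_nonneg fun x => norm_nonneg _) (fun i => ?_)
      ((h.summable_of_integrable hmem hint).mul_left C)
    simp only [F, Complex.norm_real, norm_mul, norm_pow, norm_norm]
    rw [hintegral (fun t => ‖f t‖) (by simp [hf0])]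
    exact mul_le_mul_of_nonneg_right (hC _ ⟨h.nonneg i, h.antitone (Nat.zero_le i)⟩) (h.nonneg i)
  have hswap := hasSum_integral_of_summable_integral_norm hFint hsum
  simp only [(hF _).tsum_eq, F, integral_complex_ofReal, hintegral f hf0] at hswap
  exact hswap

end CfcKernel

section Regression

variable {𝒳 S 𝓚 : Type*} [MeasurableSpace 𝒳] [MeasurableSpace S] [NormedAddCommGroup 𝓚]
  [InnerProductSpace ℂ 𝓚] [CompleteSpace 𝓚] [RKHS ℂ 𝓚 𝒳 ℂ] {μ : Measure S} {X : S → 𝒳}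
  {g : S → ℂ}

theorem regression_eq (hX : Measurable X) (hg : MemLp g 2 μ) :
    regression μ hX g = adjoint (pullback μ hX) (hg.toLp g) := by
  rw [regression, toL2, dif_pos hg]

theorem pullback_coeFn (hX : Measurable X) (u : Lp ℂ 2 (μ.map X)) :
    pullback μ hX u =ᵐ[μ] u ∘ X :=
  Lp.coeFn_compMeasurePreserving _ (hX.measurePreserving μ)

theorem inner_incl_regression (hX : Measurable X) (hmem : ∀ u : 𝓚, MemLp (⇑u) 2 (μ.map X))
    (hg : MemLp g 2 μ) (u : 𝓚) :
    ⟪incl 𝓚 (μ.map X) u, regression μ hX g⟫_ℂ = ∫ s, starRingEnd ℂ (u (X s)) * g s ∂μ := by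
  rw [regression_eq hX hg, ContinuousLinearMap.adjoint_inner_right, L2.inner_def]
  refine integral_congr_ae ?_
  filter_upwards [pullback_coeFn hX (incl 𝓚 (μ.map X) u),
    (hX.measurePreserving μ).quasiMeasurePreserving.ae (coeFn_incl hmem u),
    hg.coeFn_toLp] with s hpull hincl hs
  rw [hpull, hs, Function.comp_apply, hincl, mul_comm]
  rfl

theorem cfc_adjoint_regression_apply (hX : Measurable X)
    (hmem : ∀ u : 𝓚, MemLp (⇑u) 2 (μ.map X)) (hg : MemLp g 2 μ) (f : ℝ → ℝ) (x : 𝒳) :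
    (cfc f (covOp 𝓚 (μ.map X)) (adjoint (incl 𝓚 (μ.map X)) (regression μ hX g))) x
      = ∫ s, cfcKernel 𝓚 (μ.map X) f x (X s) * g s ∂μ := by
  have symm : ∀ u v : 𝓚, ⟪u, cfc f (covOp 𝓚 (μ.map X)) v⟫_ℂ
      = ⟪cfc f (covOp 𝓚 (μ.map X)) u, v⟫_ℂ := fun u v =>
    ((IsSelfAdjoint.cfc (f := f) (a := covOp 𝓚 (μ.map X))).isSymmetric u v).symm
  rw [← inner_kernelSection, symm, ContinuousLinearMap.adjoint_inner_right,
    inner_incl_regression hX hmem hg]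
  refine integral_congr_ae (Eventually.of_forall fun s => ?_)
  simp only [cfcKernel, symm]
  rw [← inner_kernelSection (X s), inner_conj_symm]

end Regression

/-! ### Integrals against weakly convergent measures -/

/-- Weak convergence `ν n → μ` along `l` of measures of mass at most one carried by `V`, tested on
the continuous functions that are bounded on `V` but possibly unbounded elsewhere. -/
structure WeaklyConvergesOn {α S : Type*} [TopologicalSpace S] [MeasurableSpace S]
    (l : Filter α) (ν : α → Measure S) (μ : Measure S) (V : Set S) : Prop where
  measure_univ_le : ∀ n, ν n univ ≤ 1
  limit_measure_univ_le : μ univ ≤ 1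
  ae_mem : ∀ n, ∀ᵐ s ∂ν n, s ∈ V
  limit_ae_mem : ∀ᵐ s ∂μ, s ∈ V
  tendsto_integral : ∀ g : S → ℂ, Continuous g → (∃ C, ∀ s ∈ V, ‖g s‖ ≤ C) →
    Tendsto (fun n => ∫ s, g s ∂ν n) l (𝓝 (∫ s, g s ∂μ))

theorem dist_integral_le_of_ae_dist_le {S E : Type*} [MeasurableSpace S] [NormedAddCommGroup E]
    [NormedSpace ℝ E] {ν : Measure S} (hν : ν univ ≤ 1) {f g : S → E} (hf : Integrable f ν)
    (hg : Integrable g ν) {ε : ℝ} (hε : 0 ≤ ε) (hfg : ∀ᵐ s ∂ν, dist (f s) (g s) ≤ ε) :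
    dist (∫ s, f s ∂ν) (∫ s, g s ∂ν) ≤ ε := by
  have := isFiniteMeasure_of_measure_univ_le_one hν
  rw [dist_eq_norm, ← integral_sub hf hg]
  refine (norm_integral_le_of_norm_le_const (by simpa only [dist_eq_norm] using hfg)).trans
    (mul_le_of_le_one_right hε ?_)
  exact ENNReal.toReal_mono ENNReal.one_ne_top hν

section WeaklyConvergesOn

variable {α S : Type*} [TopologicalSpace S] [MeasurableSpace S] {l : Filter α}
  {ν : α → Measure S} {μ : Measure S} {V : Set S}

theorem WeaklyConvergesOn.comp (h : WeaklyConvergesOn l ν μ V) {β : Type*} {l' : Filter β}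
    {m : β → α} (hm : Tendsto m l' l) : WeaklyConvergesOn l' (fun n => ν (m n)) μ V where
  measure_univ_le n := h.measure_univ_le (m n)
  limit_measure_univ_le := h.limit_measure_univ_le
  ae_mem n := h.ae_mem (m n)
  limit_ae_mem := h.limit_ae_mem
  tendsto_integral g hg hgV := (h.tendsto_integral g hg hgV).comp hm

theorem WeaklyConvergesOn.smul (h : WeaklyConvergesOn l ν μ V) {c : α → ℝ≥0}
    (hc : Tendsto c l (𝓝 1)) (hc1 : ∀ n, c n ≤ 1) :
    WeaklyConvergesOn l (fun n => c n • ν n) μ V where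
  measure_univ_le n := by
    rw [Measure.smul_apply, ENNReal.smul_def, smul_eq_mul]
    exact mul_le_one' (by exact_mod_cast hc1 n) (h.measure_univ_le n)
  limit_measure_univ_le := h.limit_measure_univ_le
  ae_mem n := Measure.ae_smul_measure (h.ae_mem n) (c n)
  limit_ae_mem := h.limit_ae_mem
  tendsto_integral g hg hgV := by
    simpa only [integral_smul_nnreal_measure, one_smul] using
      hc.smul (h.tendsto_integral g hg hgV)

theorem WeaklyConvergesOn.memLp_limit [OpensMeasurableSpace S] (h : WeaklyConvergesOn l ν μ V)
    {E : Type*} [NormedAddCommGroup E] [SecondCountableTopologyEither S E] {w : S → E}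
    (hw : Continuous w) (hwV : ∃ C, ∀ s ∈ V, ‖w s‖ ≤ C) (p : ℝ≥0∞) : MemLp w p μ := by
  have := isFiniteMeasure_of_measure_univ_le_one h.limit_measure_univ_le
  obtain ⟨C, hC⟩ := hwV
  exact MemLp.of_bound hw.aestronglyMeasurable C (h.limit_ae_mem.mono hC)

variable {𝒳 : Type*} [TopologicalSpace 𝒳] [MeasurableSpace 𝒳] {X : S → 𝒳} {U : Set 𝒳}

theorem WeaklyConvergesOn.map [OpensMeasurableSpace S] [BorelSpace 𝒳]
    (h : WeaklyConvergesOn l ν μ (X ⁻¹' U)) (hX : Continuous X) (hU : MeasurableSet U) :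
    WeaklyConvergesOn l (fun n => (ν n).map X) (μ.map X) U where
  measure_univ_le n := by
    rw [Measure.map_apply hX.measurable MeasurableSet.univ]
    exact h.measure_univ_le n
  limit_measure_univ_le := by
    rw [Measure.map_apply hX.measurable MeasurableSet.univ]
    exact h.limit_measure_univ_le
  ae_mem n := (ae_map_iff hX.measurable.aemeasurable hU).2 (h.ae_mem n)
  limit_ae_mem := (ae_map_iff hX.measurable.aemeasurable hU).2 h.limit_ae_mem
  tendsto_integral g hg hgU := by
    simp only [integral_map hX.measurable.aemeasurable hg.aestronglyMeasurable]
    exact h.tendsto_integral _ (hg.comp hX) (hgU.imp fun C hC s hs => hC _ hs)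

end WeaklyConvergesOn

section ParameterIntegral

theorem dist_mul_right_le {a b c : ℂ} {C ε : ℝ} (hab : dist a b < ε / (|C| + 1))
    (hc : ‖c‖ ≤ C) : dist (a * c) (b * c) ≤ ε :=
  calc dist (a * c) (b * c) = dist a b * ‖c‖ := by
        rw [dist_eq_norm, dist_eq_norm, ← sub_mul, norm_mul]
    _ ≤ ε / (|C| + 1) * (|C| + 1) := by
        gcongr
        · exact dist_nonneg.trans hab.le
        · linarith [le_abs_self C]
    _ = ε := div_mul_cancel₀ _ (by positivity)

variable {S 𝒳 P : Type*} [TopologicalSpace 𝒳] [TopologicalSpace P] {X : S → 𝒳} {U : Set 𝒳}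
  {T : Set P} {w : S → ℂ}

theorem exists_norm_mul_le (hU : IsCompact U) {F : 𝒳 → ℂ} (hF : ContinuousOn F U)
    (hw : ∃ C, ∀ s, X s ∈ U → ‖w s‖ ≤ C) : ∃ C, ∀ s ∈ X ⁻¹' U, ‖F (X s) * w s‖ ≤ C := by
  obtain ⟨B, hB⟩ := hU.exists_bound_of_continuousOn hF
  obtain ⟨C, hC⟩ := hw
  exact ⟨B * C, fun s hs => (norm_mul_le _ _).trans
    (mul_le_mul (hB _ hs) (hC s hs) (norm_nonneg _) ((norm_nonneg _).trans (hB _ hs)))⟩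

theorem exists_mem_nhdsWithin_dist_mul_le (hU : IsCompact U) {F : P → 𝒳 → ℂ}
    (hF : Continuous F.uncurry) (hw : ∃ C, ∀ s, X s ∈ U → ‖w s‖ ≤ C) {t₀ : P} (ht₀ : t₀ ∈ T)
    {ε : ℝ} (hε : 0 < ε) :
    ∃ v ∈ 𝓝[T] t₀, ∀ t ∈ v, ∀ s, X s ∈ U → dist (F t (X s) * w s) (F t₀ (X s) * w s) ≤ ε := by
  obtain ⟨C, hC⟩ := hw
  obtain ⟨v, hv, hvF⟩ := hU.mem_uniformity_of_prod hF.continuousOn ht₀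
    (Metric.dist_mem_uniformity (by positivity : 0 < ε / (|C| + 1)))
  exact ⟨v, hv, fun t ht s hs => dist_mul_right_le (hvF t ht _ hs) (hC s hs)⟩

variable [TopologicalSpace S] [MeasurableSpace S] [OpensMeasurableSpace S]

theorem integrable_mul_of_isCompact {ν : Measure S} [IsFiniteMeasure ν]
    (hν : ∀ᵐ s ∂ν, s ∈ X ⁻¹' U) (hX : Continuous X) (hU : IsCompact U) {F : 𝒳 → ℂ}
    (hF : Continuous F) (hw : Continuous w) (hwU : ∃ C, ∀ s, X s ∈ U → ‖w s‖ ≤ C) :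
    Integrable (fun s => F (X s) * w s) ν := by
  obtain ⟨C, hC⟩ := exists_norm_mul_le hU hF.continuousOn hwU
  exact Integrable.of_bound ((hF.comp hX).mul hw).aestronglyMeasurable C (hν.mono hC)

variable {α : Type*} {l : Filter α} {ν : α → Measure S} {μ : Measure S}

theorem WeaklyConvergesOn.tendstoUniformlyOn_integral_mul
    (h : WeaklyConvergesOn l ν μ (X ⁻¹' U)) (hX : Continuous X) (hU : IsCompact U)
    (hT : IsCompact T) {F : P → 𝒳 → ℂ} (hF : Continuous F.uncurry) (hw : Continuous w)
    (hwU : ∃ C, ∀ s, X s ∈ U → ‖w s‖ ≤ C) :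
    TendstoUniformlyOn (fun n t => ∫ s, F t (X s) * w s ∂ν n)
      (fun t => ∫ s, F t (X s) * w s ∂μ) l T := by
  have hFt : ∀ t, Continuous (F t) := fun t => hF.comp (Continuous.prodMk_right t)
  have := isFiniteMeasure_of_measure_univ_le_one h.limit_measure_univ_le
  have := fun n => isFiniteMeasure_of_measure_univ_le_one (h.measure_univ_le n)
  have hintegrable := fun t => integrable_mul_of_isCompact h.limit_ae_mem hX hU (hFt t) hw hwU
  have hintegrable' := fun n t => integrable_mul_of_isCompact (h.ae_mem n) hX hU (hFt t) hw hwU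
  rw [← tendstoLocallyUniformlyOn_iff_tendstoUniformlyOn_of_compact hT,
    Metric.tendstoLocallyUniformlyOn_iff]
  intro ε hε t₀ ht₀
  obtain ⟨v, hv, hvF⟩ := exists_mem_nhdsWithin_dist_mul_le hU hF hwU ht₀ (div_pos hε three_pos)
  have hpoint : Tendsto (fun n => ∫ s, F t₀ (X s) * w s ∂ν n) l
      (𝓝 (∫ s, F t₀ (X s) * w s ∂μ)) :=
    h.tendsto_integral _ (((hFt t₀).comp hX).mul hw)
      (exists_norm_mul_le hU (hFt t₀).continuousOn hwU)
  refine ⟨v, hv, ?_⟩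
  filter_upwards [Metric.tendsto_nhds.1 hpoint (ε / 3) (by positivity)] with n hn t ht
  have hlimit : dist (∫ s, F t (X s) * w s ∂μ) (∫ s, F t₀ (X s) * w s ∂μ) ≤ ε / 3 :=
    dist_integral_le_of_ae_dist_le h.limit_measure_univ_le (hintegrable t) (hintegrable t₀)
      (by positivity) (h.limit_ae_mem.mono (hvF t ht))
  have happrox : dist (∫ s, F t (X s) * w s ∂ν n) (∫ s, F t₀ (X s) * w s ∂ν n) ≤ ε / 3 :=
    dist_integral_le_of_ae_dist_le (h.measure_univ_le n) (hintegrable' n t) (hintegrable' n t₀)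
      (by positivity) ((h.ae_mem n).mono (hvF t ht))
  refine (dist_triangle4_right _ _ (∫ s, F t₀ (X s) * w s ∂μ)
    (∫ s, F t₀ (X s) * w s ∂ν n)).trans_lt ?_
  rw [dist_comm] at hn
  linarith

theorem WeaklyConvergesOn.tendstoUniformlyOn_integral_mul_of_tendstoUniformlyOn
    (h : WeaklyConvergesOn l ν μ (X ⁻¹' U)) (hX : Continuous X) (hU : IsCompact U)
    (hT : IsCompact T) {Fₙ : α → P → 𝒳 → ℂ} {F : P → 𝒳 → ℂ}
    (hFₙ : ∀ n, Continuous (Fₙ n).uncurry) (hF : Continuous F.uncurry)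
    (hlim : TendstoUniformlyOn (fun n => (Fₙ n).uncurry) F.uncurry l (T ×ˢ U))
    (hw : Continuous w) (hwU : ∃ C, ∀ s, X s ∈ U → ‖w s‖ ≤ C) :
    TendstoUniformlyOn (fun n t => ∫ s, Fₙ n t (X s) * w s ∂ν n)
      (fun t => ∫ s, F t (X s) * w s ∂μ) l T := by
  obtain ⟨C, hC⟩ := hwU
  have := fun n => isFiniteMeasure_of_measure_univ_le_one (h.measure_univ_le n)
  have hfixed := h.tendstoUniformlyOn_integral_mul hX hU hT hF hw ⟨C, hC⟩
  rw [Metric.tendstoUniformlyOn_iff] at hfixed hlim ⊢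
  intro ε hε
  filter_upwards [hfixed (ε / 2) (by positivity), hlim (ε / 2 / (|C| + 1)) (by positivity)]
    with n hn hFn t ht
  have hreplace : dist (∫ s, F t (X s) * w s ∂ν n) (∫ s, Fₙ n t (X s) * w s ∂ν n) ≤ ε / 2 := by
    have hFt := hF.comp (Continuous.prodMk_right t)
    have hFₙt := (hFₙ n).comp (Continuous.prodMk_right t)
    exact dist_integral_le_of_ae_dist_le (h.measure_univ_le n)
      (integrable_mul_of_isCompact (h.ae_mem n) hX hU hFt hw ⟨C, hC⟩)
      (integrable_mul_of_isCompact (h.ae_mem n) hX hU hFₙt hw ⟨C, hC⟩) (by positivity)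
      ((h.ae_mem n).mono fun s hs => dist_mul_right_le (hFn (t, X s) ⟨ht, hs⟩) (hC s hs))
  linarith [hn t ht, dist_triangle (∫ s, F t (X s) * w s ∂μ) (∫ s, F t (X s) * w s ∂ν n)
    (∫ s, Fₙ n t (X s) * w s ∂ν n)]

end ParameterIntegral

/-! ### Convergence of the kernels of functions of the covariance operators -/

theorem tendstoUniformlyOn_mul_of_isCompact {α Q : Type*} [TopologicalSpace Q] {l : Filter α}
    {F G : α → Q → ℂ} {f g : Q → ℂ} {K : Set Q} (hF : TendstoUniformlyOn F f l K)
    (hG : TendstoUniformlyOn G g l K) (hK : IsCompact K) (hf : ContinuousOn f K)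
    (hg : ContinuousOn g K) :
    TendstoUniformlyOn (fun n q => F n q * G n q) (fun q => f q * g q) l K := by
  rw [← tendstoLocallyUniformlyOn_iff_tendstoUniformlyOn_of_compact hK] at hF hG ⊢
  exact hF.fun_mul₀ hG hf hg

theorem tendstoUniformlyOn_of_forall_dist_le {α Q E : Type*} [PseudoMetricSpace E] {l : Filter α}
    {F : α → Q → E} {f : Q → E} {K : Set Q}
    (h : ∀ ε > 0, ∃ (G : α → Q → E) (g : Q → E), TendstoUniformlyOn G g l K ∧
      (∀ᶠ n in l, ∀ q ∈ K, dist (F n q) (G n q) ≤ ε) ∧ ∀ q ∈ K, dist (f q) (g q) ≤ ε) :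
    TendstoUniformlyOn F f l K := by
  rw [Metric.tendstoUniformlyOn_iff]
  intro ε hε
  obtain ⟨G, g, hG, hFG, hfg⟩ := h (ε / 3) (by positivity)
  filter_upwards [Metric.tendstoUniformlyOn_iff.1 hG (ε / 3) (by positivity), hFG]
    with n hn hnFG q hq
  have htriangle := dist_triangle4_right (f q) (F n q) (g q) (G n q)
  linarith [hn q hq, hnFG q hq, hfg q hq]

/-- Convergence along `l` of RKHSs `𝓚ₙ n` over `𝒳`, taken with measures `ρₙ n` carried by the
compact set `U`, to an RKHS `𝓚` taken with `ρ`: the measures converge weakly and the kernels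
converge uniformly on `U × U`. -/
structure RKHSConvergesOn {α 𝒳 : Type*} [TopologicalSpace 𝒳] [MeasurableSpace 𝒳] (l : Filter α)
    (𝓚ₙ : α → Type*) [∀ n, NormedAddCommGroup (𝓚ₙ n)] [∀ n, InnerProductSpace ℂ (𝓚ₙ n)]
    [∀ n, CompleteSpace (𝓚ₙ n)] [∀ n, RKHS ℂ (𝓚ₙ n) 𝒳 ℂ]
    (𝓚 : Type*) [NormedAddCommGroup 𝓚] [InnerProductSpace ℂ 𝓚] [CompleteSpace 𝓚] [RKHS ℂ 𝓚 𝒳 ℂ]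
    (ρₙ : α → Measure 𝒳) (ρ : Measure 𝒳) (U : Set 𝒳) : Prop where
  isCompact : IsCompact U
  measure : WeaklyConvergesOn l ρₙ ρ U
  continuous_kernel : ∀ n, Continuous fun p : 𝒳 × 𝒳 => scalarKernel (𝓚ₙ n) p.1 p.2
  continuous_limit_kernel : Continuous fun p : 𝒳 × 𝒳 => scalarKernel 𝓚 p.1 p.2
  tendsto_kernel : TendstoUniformlyOn (fun n (p : 𝒳 × 𝒳) => scalarKernel (𝓚ₙ n) p.1 p.2)
    (fun p => scalarKernel 𝓚 p.1 p.2) l (U ×ˢ U)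

section RKHSConvergesOn

variable {α 𝒳 : Type*} [MetricSpace 𝒳] [MeasurableSpace 𝒳] {l : Filter α}
  {𝓚ₙ : α → Type*} [∀ n, NormedAddCommGroup (𝓚ₙ n)] [∀ n, InnerProductSpace ℂ (𝓚ₙ n)]
  [∀ n, CompleteSpace (𝓚ₙ n)] [∀ n, RKHS ℂ (𝓚ₙ n) 𝒳 ℂ]
  {𝓚 : Type*} [NormedAddCommGroup 𝓚] [InnerProductSpace ℂ 𝓚] [CompleteSpace 𝓚] [RKHS ℂ 𝓚 𝒳 ℂ]
  {ρₙ : α → Measure 𝒳} {ρ : Measure 𝒳} {U : Set 𝒳}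

theorem RKHSConvergesOn.exists_norm_kernel_le (h : RKHSConvergesOn l 𝓚ₙ 𝓚 ρₙ ρ U) :
    ∃ B, 0 ≤ B ∧ (∀ x ∈ U, ‖scalarKernel 𝓚 x x‖ ≤ B) ∧
      ∀ᶠ n in l, ∀ x ∈ U, ‖scalarKernel (𝓚ₙ n) x x‖ ≤ B := by
  obtain ⟨C, hC⟩ := (h.isCompact.prod h.isCompact).exists_bound_of_continuousOn
    h.continuous_limit_kernel.continuousOn
  have hlimit : ∀ x ∈ U, ‖scalarKernel 𝓚 x x‖ ≤ |C| := fun x hx =>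
    (hC (x, x) ⟨hx, hx⟩).trans (le_abs_self C)
  refine ⟨|C| + 1, by positivity, fun x hx => by linarith [hlimit x hx], ?_⟩
  filter_upwards [Metric.tendstoUniformlyOn_iff.1 h.tendsto_kernel 1 one_pos] with n hn x hx
  have hdist : ‖scalarKernel (𝓚ₙ n) x x - scalarKernel 𝓚 x x‖ < 1 := by
    rw [← dist_eq_norm, dist_comm]
    exact hn (x, x) ⟨hx, hx⟩
  linarith [norm_sub_norm_le (scalarKernel (𝓚ₙ n) x x) (scalarKernel 𝓚 x x), hlimit x hx]

variable [BorelSpace 𝒳]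

theorem RKHSConvergesOn.memLp (h : RKHSConvergesOn l 𝓚ₙ 𝓚 ρₙ ρ U) (n : α) (u : 𝓚ₙ n) :
    MemLp (⇑u) 2 (ρₙ n) :=
  have := isFiniteMeasure_of_measure_univ_le_one (h.measure.measure_univ_le n)
  memLp_of_continuous_kernel (h.continuous_kernel n) (ρₙ n) h.isCompact (h.measure.ae_mem n) u

theorem RKHSConvergesOn.memLp_limit (h : RKHSConvergesOn l 𝓚ₙ 𝓚 ρₙ ρ U) (u : 𝓚) :
    MemLp (⇑u) 2 ρ :=
  have := isFiniteMeasure_of_measure_univ_le_one h.measure.limit_measure_univ_le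
  memLp_of_continuous_kernel h.continuous_limit_kernel ρ h.isCompact h.measure.limit_ae_mem u

theorem RKHSConvergesOn.tendstoUniformlyOn_cfcKernel_id_mul
    (h : RKHSConvergesOn l 𝓚ₙ 𝓚 ρₙ ρ U) {f : ℝ → ℝ} (hf : Continuous f)
    (hlim : TendstoUniformlyOn (fun n (p : 𝒳 × 𝒳) => cfcKernel (𝓚ₙ n) (ρₙ n) f p.1 p.2)
      (fun (p : 𝒳 × 𝒳) => cfcKernel 𝓚 ρ f p.1 p.2) l (U ×ˢ U)) :
    TendstoUniformlyOn (fun n (p : 𝒳 × 𝒳) => cfcKernel (𝓚ₙ n) (ρₙ n) (fun t => t * f t) p.1 p.2)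
      (fun (p : 𝒳 × 𝒳) => cfcKernel 𝓚 ρ (fun t => t * f t) p.1 p.2) l (U ×ˢ U) := by
  have hleft : Continuous fun p : (𝒳 × 𝒳) × 𝒳 => (p.1.1, p.2) := by fun_prop
  have hright : Continuous fun p : (𝒳 × 𝒳) × 𝒳 => (p.2, p.1.2) := by fun_prop
  have hUU := h.isCompact.prod h.isCompact
  have hkₙ := fun n => (h.continuous_kernel n).comp hleft
  have hk := h.continuous_limit_kernel.comp hleft
  have hmₙ := fun n => (continuous_cfcKernel (ρ := ρₙ n) (h.continuous_kernel n) f).comp hright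
  have hm := (continuous_cfcKernel (ρ := ρ) h.continuous_limit_kernel f).comp hright
  have hkU := (h.tendsto_kernel.comp fun p : (𝒳 × 𝒳) × 𝒳 => (p.1.1, p.2)).mono
    (s' := (U ×ˢ U) ×ˢ U) fun p hp => ⟨hp.1.1, hp.2⟩
  have hmU := (hlim.comp fun p : (𝒳 × 𝒳) × 𝒳 => (p.2, p.1.2)).mono
    (s' := (U ×ˢ U) ×ˢ U) fun p hp => ⟨hp.2, hp.1.2⟩
  have hprod := tendstoUniformlyOn_mul_of_isCompact hkU hmU (hUU.prod h.isCompact)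
    hk.continuousOn hm.continuousOn
  have hint := h.measure.tendstoUniformlyOn_integral_mul_of_tendstoUniformlyOn (X := id)
    (Fₙ := fun n p y => scalarKernel (𝓚ₙ n) p.1 y * cfcKernel (𝓚ₙ n) (ρₙ n) f y p.2)
    (F := fun p y => scalarKernel 𝓚 p.1 y * cfcKernel 𝓚 ρ f y p.2) (w := fun _ => 1)
    continuous_id h.isCompact hUU (fun n => (hkₙ n).mul (hmₙ n)) (hk.mul hm) hprod
    continuous_const ⟨1, by simp⟩
  simpa only [cfcKernel_id_mul (h.memLp _) hf, cfcKernel_id_mul h.memLp_limit hf, mul_one, id]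
    using hint

theorem RKHSConvergesOn.tendstoUniformlyOn_cfcKernel (h : RKHSConvergesOn l 𝓚ₙ 𝓚 ρₙ ρ U)
    {f : ℝ → ℝ} (hf : Continuous f) :
    TendstoUniformlyOn (fun n (p : 𝒳 × 𝒳) => cfcKernel (𝓚ₙ n) (ρₙ n) f p.1 p.2)
      (fun (p : 𝒳 × 𝒳) => cfcKernel 𝓚 ρ f p.1 p.2) l (U ×ˢ U) := by
  obtain ⟨B, hB0, hB, hBn⟩ := h.exists_norm_kernel_le
  refine continuous_induction (P := fun f => TendstoUniformlyOn
    (fun n (p : 𝒳 × 𝒳) => cfcKernel (𝓚ₙ n) (ρₙ n) f p.1 p.2)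
    (fun (p : 𝒳 × 𝒳) => cfcKernel 𝓚 ρ f p.1 p.2) l (U ×ˢ U))
    B (fun a => ?_) (fun f g hf hg hfU hgU => ?_)
    (fun f hf => h.tendstoUniformlyOn_cfcKernel_id_mul hf) (fun f hf happrox => ?_) hf
  · simp only [cfcKernel_const]
    exact (uniformContinuous_const_smul (a : ℂ)).comp_tendstoUniformlyOn h.tendsto_kernel
  · simp only [cfcKernel_add hf hg]
    exact hfU.add hgU
  · refine tendstoUniformlyOn_of_forall_dist_le fun ε hε => ?_
    obtain ⟨g, hg, hgU, hfg⟩ := happrox (ε / (B + 1)) (by positivity)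
    have hεB : ε / (B + 1) * B ≤ ε := by
      rw [div_mul_eq_mul_div]
      exact div_le_of_le_mul₀ (by positivity) hε.le (by linarith)
    refine ⟨_, _, hgU, hBn.mono fun n hn p hp => ?_, fun p hp => ?_⟩
    · exact (dist_eq_norm _ _).trans_le ((norm_cfcKernel_sub_cfcKernel_le (h.memLp n)
        (h.measure.measure_univ_le n) (h.measure.ae_mem n) hB0 hn hf hg (by positivity) hfg
        hp.1 hp.2).trans hεB)
    · exact (dist_eq_norm _ _).trans_le ((norm_cfcKernel_sub_cfcKernel_le h.memLp_limit
        h.measure.limit_measure_univ_le h.measure.limit_ae_mem hB0 hB hf hg (by positivity) hfg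
        hp.1 hp.2).trans hεB)

theorem RKHSConvergesOn.tendsto_integral_cfcKernel (h : RKHSConvergesOn l 𝓚ₙ 𝓚 ρₙ ρ U)
    {f : ℝ → ℝ} (hf : Continuous f) :
    Tendsto (fun n => ∫ x, cfcKernel (𝓚ₙ n) (ρₙ n) f x x ∂ρₙ n) l
      (𝓝 (∫ x, cfcKernel 𝓚 ρ f x x ∂ρ)) := by
  have hdiagonal : Continuous fun p : Unit × 𝒳 => (p.2, p.2) := by fun_prop
  have hFₙ := fun n => (continuous_cfcKernel (ρ := ρₙ n) (h.continuous_kernel n) f).comp hdiagonal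
  have hlim := ((h.tendstoUniformlyOn_cfcKernel hf).comp fun p : Unit × 𝒳 => (p.2, p.2)).mono
    (s' := univ ×ˢ U) fun p hp => ⟨hp.2, hp.2⟩
  have hF := (continuous_cfcKernel (ρ := ρ) h.continuous_limit_kernel f).comp hdiagonal
  have hint := h.measure.tendstoUniformlyOn_integral_mul_of_tendstoUniformlyOn (X := id)
    (Fₙ := fun n (_ : Unit) x => cfcKernel (𝓚ₙ n) (ρₙ n) f x x)
    (F := fun _ x => cfcKernel 𝓚 ρ f x x) (w := fun _ => 1)
    continuous_id h.isCompact isCompact_univ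
    hFₙ hF hlim continuous_const ⟨1, by simp⟩
  simpa only [mul_one, id] using hint.tendsto_at (mem_univ ())

end RKHSConvergesOn

/-! ### Convergence of eigenvalues and of target functions -/

/-- A continuous truncation of `t ↦ t⁻¹` that vanishes on `(-∞, c]` and is exact on `[d, ∞)`. -/
structure IsCutoffInv (c d : ℝ) (f : ℝ → ℝ) : Prop where
  pos : 0 < c
  lt : c < d
  continuous : Continuous f
  eq_zero : ∀ t ≤ c, f t = 0
  eq_inv : ∀ t, d ≤ t → f t = t⁻¹
  mul_mem : ∀ t, f t * t ∈ Icc (0 : ℝ) 1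

theorem exists_isCutoffInv {c d : ℝ} (hc : 0 < c) (hcd : c < d) : ∃ f, IsCutoffInv c d f := by
  have hdc : 0 < d - c := sub_pos.2 hcd
  have hzero : ∀ t ≤ c, max 0 (min 1 ((t - c) / (d - c))) = 0 := fun t ht =>
    max_eq_left ((min_le_right _ _).trans (div_nonpos_of_nonpos_of_nonneg (by linarith) hdc.le))
  refine ⟨fun t => max 0 (min 1 ((t - c) / (d - c))) * (max t c)⁻¹, hc, hcd, ?_, fun t ht => ?_,
    fun t ht => ?_, fun t => ?_⟩
  · have hmax : ∀ t, max t c ≠ 0 := fun t => (hc.trans_le (le_max_right t c)).ne'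
    fun_prop (disch := exact hmax _)
  · rw [hzero t ht, zero_mul]
  · rw [min_eq_left ((one_le_div hdc).2 (by linarith)), max_eq_right zero_le_one, one_mul,
      max_eq_left (hcd.le.trans ht)]
  · rcases le_total t c with ht | ht
    · simp [hzero t ht]
    · rw [max_eq_left ht, mul_assoc, inv_mul_cancel₀ (hc.trans_le ht).ne', mul_one]
      exact ⟨le_max_left _ _, max_le zero_le_one (min_le_left _ _)⟩

section Counting

variable {c d s : ℝ} {f : ℝ → ℝ} {lam : ℕ → ℝ}

theorem IsCutoffInv.hasSum_le (hf : IsCutoffInv c d f) (hlam : Antitone lam)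
    (hs : HasSum (fun i => f (lam i) * lam i) s) {i : ℕ} (hi : lam i ≤ c) : s ≤ i := by
  have hfinite : HasSum (fun j => f (lam j) * lam j)
      (∑ j ∈ Finset.range i, f (lam j) * lam j) := hasSum_sum_of_ne_finset_zero fun j hj => by
    rw [hf.eq_zero _ ((hlam (by simpa using hj)).trans hi), zero_mul]
  rw [hs.unique hfinite]
  simpa using Finset.sum_le_card_nsmul (Finset.range i) _ 1 fun j _ => (hf.mul_mem (lam j)).2

theorem IsCutoffInv.le_hasSum (hf : IsCutoffInv c d f) (hlam : Antitone lam)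
    (hs : HasSum (fun i => f (lam i) * lam i) s) {i : ℕ} (hi : d ≤ lam i) : (i + 1 : ℝ) ≤ s := by
  have hone : ∀ j ∈ Finset.range (i + 1), f (lam j) * lam j = 1 := fun j hj => by
    have hj : d ≤ lam j := hi.trans (hlam (Finset.mem_range_succ_iff.1 hj))
    rw [hf.eq_inv _ hj, inv_mul_cancel₀ (hf.pos.trans (hf.lt.trans_le hj)).ne']
  have hle := sum_le_hasSum (Finset.range (i + 1)) (fun j _ => (hf.mul_mem (lam j)).1) hs
  rw [Finset.sum_congr rfl hone] at hle
  simpa using hle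

end Counting

theorem IsEigensystem.target_eq_cfc_of_isCutoffInv {𝓚 H : Type*} [NormedAddCommGroup 𝓚]
    [InnerProductSpace ℂ 𝓚] [CompleteSpace 𝓚] [NormedAddCommGroup H] [InnerProductSpace ℂ H]
    [CompleteSpace H] {ι : 𝓚 →L[ℂ] H} {lam : ℕ → ℝ} {φ : ℕ → H}
    (h : IsEigensystem (ι ∘L adjoint ι) lam φ) {c d : ℝ} {f : ℝ → ℝ} (hf : IsCutoffInv c d f)
    {m : ℕ} (hd : d ≤ lam m) (hc : lam (m + 1) ≤ c) (Z : H) :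
    target ι lam φ (m + 1) Z = cfc f (adjoint ι ∘L ι) (adjoint ι Z) := by
  have hle : ∀ i < m + 1, d ≤ lam i := fun i hi => hd.trans (h.antitone (Nat.lt_succ_iff.1 hi))
  exact h.target_eq_cfc (fun i hi => hf.pos.trans (hf.lt.trans_le (hle i hi))) hf.continuous
    (hf.eq_zero 0 hf.pos.le) (fun i hi => hf.eq_inv _ (hle i hi))
    (fun i hi => hf.eq_zero _ ((h.antitone hi).trans hc)) Z

section RKHSConvergesOn

variable {α 𝒳 : Type*} [MetricSpace 𝒳] [MeasurableSpace 𝒳] [BorelSpace 𝒳] {l : Filter α}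
  {𝓚ₙ : α → Type*} [∀ n, NormedAddCommGroup (𝓚ₙ n)] [∀ n, InnerProductSpace ℂ (𝓚ₙ n)]
  [∀ n, CompleteSpace (𝓚ₙ n)] [∀ n, RKHS ℂ (𝓚ₙ n) 𝒳 ℂ]
  {𝓚 : Type*} [NormedAddCommGroup 𝓚] [InnerProductSpace ℂ 𝓚] [CompleteSpace 𝓚] [RKHS ℂ 𝓚 𝒳 ℂ]
  {ρₙ : α → Measure 𝒳} {ρ : Measure 𝒳} {U : Set 𝒳}
  {lamₙ : α → ℕ → ℝ} {φₙ : ∀ n, ℕ → Lp ℂ 2 (ρₙ n)} {lam : ℕ → ℝ} {φ : ℕ → Lp ℂ 2 ρ}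

theorem IsEigensystem.hasSum_cutoffInv_mul (heig : IsEigensystem (kernelOp 𝓚 ρ) lam φ)
    [IsFiniteMeasure ρ] (hU : IsCompact U) (hρ : ∀ᵐ x ∂ρ, x ∈ U)
    (hk : Continuous fun p : 𝒳 × 𝒳 => scalarKernel 𝓚 p.1 p.2) {c d : ℝ} {f : ℝ → ℝ}
    (hf : IsCutoffInv c d f) :
    HasSum (fun i => f (lam i) * lam i) (∫ x, cfcKernel 𝓚 ρ f x x ∂ρ).re := by
  have hdiagonal : Continuous fun x : 𝒳 => (x, x) := by fun_prop
  have hdiag := hk.comp hdiagonal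
  obtain ⟨C, hC⟩ := hU.exists_bound_of_continuousOn hdiag.continuousOn
  have hint : Integrable (fun x => scalarKernel 𝓚 x x) ρ :=
    Integrable.of_bound hdiag.aestronglyMeasurable C (hρ.mono hC)
  have hψ : IsEigensystem (covOp 𝓚 ρ) lam (KAF.psi (incl 𝓚 ρ) lam φ) := heig.adjoint_comp_self
  have hsum := hψ.hasSum_integral_cfcKernel (memLp_of_continuous_kernel hk ρ hU hρ) hint
    hf.continuous (hf.eq_zero 0 hf.pos.le)
  exact_mod_cast Complex.hasSum_re hsum

theorem RKHSConvergesOn.tendsto_eigenvalue (h : RKHSConvergesOn l 𝓚ₙ 𝓚 ρₙ ρ U)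
    (heigₙ : ∀ n, IsEigensystem (kernelOp (𝓚ₙ n) (ρₙ n)) (lamₙ n) (φₙ n))
    (heig : IsEigensystem (kernelOp 𝓚 ρ) lam φ) (i : ℕ) :
    Tendsto (fun n => lamₙ n i) l (𝓝 (lam i)) := by
  have := isFiniteMeasure_of_measure_univ_le_one h.measure.limit_measure_univ_le
  have := fun n => isFiniteMeasure_of_measure_univ_le_one (h.measure.measure_univ_le n)
  have hsumₙ := fun n {c d : ℝ} {f : ℝ → ℝ} (hf : IsCutoffInv c d f) =>
    (heigₙ n).hasSum_cutoffInv_mul h.isCompact (h.measure.ae_mem n) (h.continuous_kernel n) hf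
  have hsum := fun {c d : ℝ} {f : ℝ → ℝ} (hf : IsCutoffInv c d f) =>
    heig.hasSum_cutoffInv_mul h.isCompact h.measure.limit_ae_mem h.continuous_limit_kernel hf
  have hlim : ∀ f, Continuous f →
      Tendsto (fun n => (∫ x, cfcKernel (𝓚ₙ n) (ρₙ n) f x x ∂ρₙ n).re) l
        (𝓝 (∫ x, cfcKernel 𝓚 ρ f x x ∂ρ).re) := fun f hf =>
    (Complex.continuous_re.tendsto _).comp (h.tendsto_integral_cfcKernel hf)
  refine tendsto_order.2 ⟨fun a ha => ?_, fun a ha => ?_⟩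
  · rcases lt_or_ge a 0 with ha0 | ha0
    · exact Eventually.of_forall fun n => ha0.trans_le ((heigₙ n).nonneg i)
    obtain ⟨c, hac, hc⟩ := exists_between ha
    obtain ⟨f, hf⟩ := exists_isCutoffInv (ha0.trans_lt hac) hc
    have hcount := hf.le_hasSum heig.antitone (hsum hf) le_rfl
    filter_upwards [(hlim f hf.continuous).eventually_const_lt
      ((lt_add_one (i : ℝ)).trans_le hcount)] with n hn
    by_contra! hle
    exact hn.not_ge (hf.hasSum_le (heigₙ n).antitone (hsumₙ n hf) (hle.trans hac.le))
  · obtain ⟨c, hc, hca⟩ := exists_between ha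
    obtain ⟨f, hf⟩ := exists_isCutoffInv ((heig.nonneg i).trans_lt hc) hca
    have hcount := hf.hasSum_le heig.antitone (hsum hf) hc.le
    filter_upwards [(hlim f hf.continuous).eventually_lt_const (hcount.trans_lt (lt_add_one _))]
      with n hn
    by_contra! hle
    exact hn.not_ge (hf.le_hasSum (heigₙ n).antitone (hsumₙ n hf) hle)

theorem RKHSConvergesOn.tendstoUniformlyOn_target (h : RKHSConvergesOn l 𝓚ₙ 𝓚 ρₙ ρ U)
    (heigₙ : ∀ n, IsEigensystem (kernelOp (𝓚ₙ n) (ρₙ n)) (lamₙ n) (φₙ n))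
    (heig : IsEigensystem (kernelOp 𝓚 ρ) lam φ) {m : ℕ} (hgap : lam (m + 1) < lam m)
    {Zₙ : ∀ n, Lp ℂ 2 (ρₙ n)} {Z : Lp ℂ 2 ρ}
    (hZ : ∀ f : ℝ → ℝ, Continuous f → TendstoUniformlyOn
      (fun n x => (cfc f (covOp (𝓚ₙ n) (ρₙ n)) (adjoint (incl (𝓚ₙ n) (ρₙ n)) (Zₙ n))) x)
      (fun x => (cfc f (covOp 𝓚 ρ) (adjoint (incl 𝓚 ρ) Z)) x) l U) :
    TendstoUniformlyOn
      (fun n x => target (incl (𝓚ₙ n) (ρₙ n)) (lamₙ n) (φₙ n) (m + 1) (Zₙ n) x)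
      (fun x => target (incl 𝓚 ρ) lam φ (m + 1) Z x) l U := by
  obtain ⟨c, hc, hcm⟩ := exists_between hgap
  obtain ⟨d, hcd, hd⟩ := exists_between hcm
  obtain ⟨f, hf⟩ := exists_isCutoffInv ((heig.nonneg _).trans_lt hc) hcd
  rw [IsEigensystem.target_eq_cfc_of_isCutoffInv heig hf hd.le hc.le]
  refine (hZ f hf.continuous).congr ?_
  filter_upwards [(h.tendsto_eigenvalue heigₙ heig m).eventually_const_le hd,
    (h.tendsto_eigenvalue heigₙ heig (m + 1)).eventually_le_const hc] with n hdn hcn x _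
  beta_reduce
  rw [IsEigensystem.target_eq_cfc_of_isCutoffInv (heigₙ n) hf hdn hcn]
  rfl

theorem RKHSConvergesOn.tendstoUniformlyOn_integral_cfcKernel_mul
    (h : RKHSConvergesOn l 𝓚ₙ 𝓚 ρₙ ρ U) {S : Type*} [TopologicalSpace S] [MeasurableSpace S]
    [OpensMeasurableSpace S] {ν : α → Measure S} {μ : Measure S} {X : S → 𝒳} (hX : Continuous X)
    (hν : WeaklyConvergesOn l ν μ (X ⁻¹' U)) {w : S → ℂ} (hw : Continuous w)
    (hwU : ∃ C, ∀ s, X s ∈ U → ‖w s‖ ≤ C) {f : ℝ → ℝ} (hf : Continuous f) :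
    TendstoUniformlyOn (fun n x => ∫ s, cfcKernel (𝓚ₙ n) (ρₙ n) f x (X s) * w s ∂ν n)
      (fun x => ∫ s, cfcKernel 𝓚 ρ f x (X s) * w s ∂μ) l U :=
  hν.tendstoUniformlyOn_integral_mul_of_tendstoUniformlyOn hX h.isCompact h.isCompact
    (fun n => continuous_cfcKernel (h.continuous_kernel n) f)
    (continuous_cfcKernel h.continuous_limit_kernel f) (h.tendstoUniformlyOn_cfcKernel hf) hw hwU

end RKHSConvergesOn

/-! ### Weak convergence of empirical measures -/

/-- The clamp `ω ↦ (B / max B ‖g ω‖) * g ω` of `g` to norm at most `B`, which turns a function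
bounded by `B` on a subset only into a function bounded everywhere. -/
def normClamp {Ω : Type*} (B : ℝ) (g : Ω → ℂ) (ω : Ω) : ℂ := ((B / max B ‖g ω‖ : ℝ) : ℂ) * g ω

theorem continuous_normClamp {Ω : Type*} [TopologicalSpace Ω] {B : ℝ} (hB : 0 < B) {g : Ω → ℂ}
    (hg : Continuous g) : Continuous (normClamp B g) :=
  (Complex.continuous_ofReal.comp (continuous_const.div (continuous_const.max hg.norm)
    fun _ => (lt_max_of_lt_left hB).ne')).mul hg

theorem norm_normClamp_le {Ω : Type*} {B : ℝ} (hB : 0 < B) (g : Ω → ℂ) (ω : Ω) :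
    ‖normClamp B g ω‖ ≤ B := by
  have hmax : 0 < max B ‖g ω‖ := lt_max_of_lt_left hB
  rw [normClamp, norm_mul, Complex.norm_real, Real.norm_of_nonneg (by positivity),
    div_mul_eq_mul_div, div_le_iff₀ hmax]
  gcongr
  exact le_max_right _ _

theorem normClamp_of_norm_le {Ω : Type*} {B : ℝ} (hB : 0 < B) {g : Ω → ℂ} {ω : Ω} (h : ‖g ω‖ ≤ B) :
    normClamp B g ω = g ω := by
  rw [normClamp, max_eq_left h, div_self hB.ne', Complex.ofReal_one, one_mul]

section WeakConvergence

variable {ι Ω 𝒳 : Type*} [TopologicalSpace Ω] [MeasurableSpace Ω] {l : Filter ι}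
  {ν : ι → Measure Ω} {μ : Measure Ω} {V : Set Ω}

theorem WeaklyConvergesOn.of_boundedContinuous (hν : ∀ n, ν n univ ≤ 1) (hμ : μ univ ≤ 1)
    (hνV : ∀ n, ∀ᵐ ω ∂ν n, ω ∈ V) (hμV : ∀ᵐ ω ∂μ, ω ∈ V)
    (hweak : ∀ g : BoundedContinuousFunction Ω ℂ,
      Tendsto (fun n => ∫ ω, g ω ∂ν n) l (𝓝 (∫ ω, g ω ∂μ))) :
    WeaklyConvergesOn l ν μ V where
  measure_univ_le := hν
  limit_measure_univ_le := hμ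
  ae_mem := hνV
  limit_ae_mem := hμV
  tendsto_integral := by
    rintro g hg ⟨C, hC⟩
    have hB : 0 < |C| + 1 := by positivity
    have hclamp : ∀ ω ∈ V, normClamp (|C| + 1) g ω = g ω := fun ω hω =>
      normClamp_of_norm_le hB (by linarith [hC ω hω, le_abs_self C])
    have hlim := hweak (BoundedContinuousFunction.ofNormedAddCommGroup _
      (continuous_normClamp hB hg) _ (norm_normClamp_le hB g))
    simp only [BoundedContinuousFunction.coe_ofNormedAddCommGroup] at hlim
    rw [integral_congr_ae (hμV.mono hclamp)] at hlim
    exact hlim.congr fun n => integral_congr_ae ((hνV n).mono hclamp)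

theorem ae_mem_of_isClosed_of_tendsto [OpensMeasurableSpace Ω] [HasOuterApproxClosed Ω] [l.NeBot]
    {ν : ι → ProbabilityMeasure Ω} {μ : ProbabilityMeasure Ω} (hlim : Tendsto ν l (𝓝 μ))
    (hV : IsClosed V) (hν : ∀ n, ∀ᵐ ω ∂(ν n : Measure Ω), ω ∈ V) :
    ∀ᵐ ω ∂(μ : Measure Ω), ω ∈ V := by
  have hle := ProbabilityMeasure.le_liminf_measure_open_of_tendsto hlim hV.isOpen_compl
  have hzero : ∀ n, (ν n : Measure Ω) Vᶜ = 0 := hν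
  simp only [hzero, liminf_const, nonpos_iff_eq_zero] at hle
  exact hle

theorem mem_support_map_of_mem_support [OpensMeasurableSpace Ω] [TopologicalSpace 𝒳]
    [MeasurableSpace 𝒳] [BorelSpace 𝒳] {X : Ω → 𝒳} (hX : Continuous X) {ω : Ω}
    (hω : ω ∈ μ.support) : X ω ∈ (μ.map X).support := by
  rw [Measure.mem_support_iff_forall] at hω ⊢
  intro W hW
  exact (hω _ (hX.continuousAt.preimage_mem_nhds hW)).trans_le
    (Measure.le_map_apply hX.measurable.aemeasurable W)

end WeakConvergence

theorem ae_mem_support_of_ae_mem_isSeparable {Ω : Type*} [PseudoMetricSpace Ω] [MeasurableSpace Ω]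
    {μ : Measure Ω} {S : Set Ω} (hS : TopologicalSpace.IsSeparable S)
    (hμ : ∀ᵐ ω ∂μ, ω ∈ S) : ∀ᵐ ω ∂μ, ω ∈ μ.support := by
  have hlindelof : IsLindelof (S ∩ μ.supportᶜ) := by
    have := (hS.mono (inter_subset_left (t := μ.supportᶜ))).separableSpace
    have := UniformSpace.secondCountable_of_separable ↥(S ∩ μ.supportᶜ)
    exact isLindelof_iff_isLindelof_univ.2 isLindelof_univ
  have hnull : ∀ᵐ ω ∂μ, ω ∉ S ∩ μ.supportᶜ := by
    refine hlindelof.compl_mem_sets_of_nhdsWithin fun ω hω => ?_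
    obtain ⟨W, hW, hW0⟩ := Measure.notMem_support_iff_exists.1 hω.2
    exact ⟨W, mem_nhdsWithin_of_mem_nhds hW, compl_mem_ae_iff.2 hW0⟩
  filter_upwards [hμ, hnull] with ω hωS hω
  by_contra hωμ
  exact hω ⟨hωS, hωμ⟩

section Empirical

variable {S : Type*} [MeasurableSpace S] {p : ℕ → S}

theorem indexMeasure_univ (n : ℕ) : indexMeasure n univ = (n : ℝ≥0∞)⁻¹ * n := by
  rw [indexMeasure, Measure.smul_apply, Measure.count_univ, ENat.card_eq_coe_fintype_card,
    Fintype.card_fin, smul_eq_mul, ENat.toENNReal_coe]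

instance isProbabilityMeasure_indexMeasure (n : ℕ) [NeZero n] :
    IsProbabilityMeasure (indexMeasure n) :=
  ⟨by rw [indexMeasure_univ, ENNReal.inv_mul_cancel (NeZero.ne _) (ENNReal.natCast_ne_top n)]⟩

instance isFiniteMeasure_indexMeasure (n : ℕ) : IsFiniteMeasure (indexMeasure n) :=
  isFiniteMeasure_of_measure_univ_le_one ((indexMeasure_univ n).trans_le (ENNReal.inv_mul_le_one _))

instance isProbabilityMeasure_empMeasure (p : ℕ → S) (n : ℕ) [NeZero n] :
    IsProbabilityMeasure (empMeasure p n) :=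
  Measure.isProbabilityMeasure_map Measurable.of_discrete.aemeasurable

theorem empMeasure_univ_le_one (p : ℕ → S) (n : ℕ) : empMeasure p n univ ≤ 1 := by
  rw [empMeasure, Measure.map_apply Measurable.of_discrete MeasurableSet.univ, preimage_univ,
    indexMeasure_univ]
  exact ENNReal.inv_mul_le_one _

theorem ae_empMeasure_mem {V : Set S} (hV : MeasurableSet V) (hp : ∀ j, p j ∈ V) (n : ℕ) :
    ∀ᵐ s ∂(empMeasure p n), s ∈ V :=
  (ae_map_iff Measurable.of_discrete.aemeasurable hV).2 (Eventually.of_forall fun j => hp j)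

theorem map_empMeasure {T : Type*} [MeasurableSpace T] {X : S → T} (hX : Measurable X) (p : ℕ → S)
    (n : ℕ) : (empMeasure p n).map X = empMeasure (fun j => X (p j)) n :=
  Measure.map_map hX Measurable.of_discrete

theorem memLp_indexMeasure (n : ℕ) (u : Fin n → ℂ) : MemLp u 2 (indexMeasure n) :=
  MemLp.of_bound (by fun_prop) (∑ j, ‖u j‖) (Eventually.of_forall fun j =>
    Finset.single_le_sum (f := fun j => ‖u j‖) (fun _ _ => norm_nonneg _) (Finset.mem_univ j))

theorem integral_indexMeasure (n : ℕ) (g : ℕ → ℂ) :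
    ∫ j : Fin n, g j ∂(indexMeasure n) = (n : ℂ)⁻¹ * ∑ j ∈ Finset.range n, g j := by
  rw [indexMeasure, integral_smul_measure, integral_count, ← Fin.sum_univ_eq_sum_range]
  simp

theorem integral_empMeasure [MeasurableSingletonClass S] (p : ℕ → S) (n : ℕ) (g : S → ℂ) :
    ∫ s, g s ∂(empMeasure p n) = (n : ℂ)⁻¹ * ∑ j ∈ Finset.range n, g (p j) := by
  rw [empMeasure_eq_sum_dirac, integral_smul_measure,
    integral_finsetSum_measure fun i _ => integrable_dirac (by simp)]
  simp

theorem integral_mul_analogVec [MeasurableSingletonClass S] {y : ℕ → ℂ} {q : ℕ} {w : S → ℂ}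
    (hy : ∀ j, y (j + q) = w (p j)) (n : ℕ) (F : S → ℂ) :
    ∫ j : Fin n, F (p j) * analogVec y q n j ∂(indexMeasure n)
      = ∫ s, F s * w s ∂(((n - q : ℕ) / n : ℝ≥0) • empMeasure p (n - q)) := by
  let a : ℕ → ℂ := fun j => if j + q < n then F (p j) * w (p j) else 0
  have hpad : ∀ j : Fin n, F (p j) * analogVec y q n j = a j := fun j => by
    simp only [analogVec, a, hy, mul_ite, mul_zero]
  have hsum : ∑ j ∈ Finset.range n, a j = ∑ j ∈ Finset.range (n - q), F (p j) * w (p j) := by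
    rw [← Finset.sum_filter]
    refine Finset.sum_congr (Finset.ext fun j => ?_) fun _ _ => rfl
    simp only [Finset.mem_filter, Finset.mem_range]
    omega
  simp only [hpad]
  rw [integral_indexMeasure, hsum, integral_smul_nnreal_measure, integral_empMeasure,
    NNReal.smul_def, Complex.real_smul]
  rcases Nat.eq_zero_or_pos (n - q) with h | h
  · simp [h]
  · have hne : ((n - q : ℕ) : ℂ) ≠ 0 := by exact_mod_cast h.ne'
    simp only [NNReal.coe_div, NNReal.coe_natCast, Complex.ofReal_div, Complex.ofReal_natCast]
    field_simp

theorem WeaklyConvergesOn.smul_empMeasure_sub [TopologicalSpace S] {μ : Measure S} {V : Set S}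
    (h : WeaklyConvergesOn atTop (empMeasure p) μ V) (q : ℕ) :
    WeaklyConvergesOn atTop (fun n => ((n - q : ℕ) / n : ℝ≥0) • empMeasure p (n - q)) μ V := by
  refine (h.comp (tendsto_sub_atTop_nat q)).smul ?_ fun n => ?_
  · rw [← tendsto_add_atTop_iff_nat q, ← NNReal.tendsto_coe]
    simpa using tendsto_natCast_div_add_atTop (q : ℝ)
  · exact div_le_one_of_le₀ (by exact_mod_cast Nat.sub_le n q) zero_le

theorem WeaklyConvergesOn.map_empMeasure [TopologicalSpace S] [OpensMeasurableSpace S]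
    {μ : Measure S} {T : Type*} [TopologicalSpace T] [MeasurableSpace T] [BorelSpace T] {X : S → T}
    {U : Set T} (h : WeaklyConvergesOn atTop (empMeasure p) μ (X ⁻¹' U)) (hX : Continuous X)
    (hU : MeasurableSet U) :
    WeaklyConvergesOn atTop (empMeasure fun j => X (p j)) (μ.map X) U :=
  (funext fun n => KAF.map_empMeasure hX.measurable p n) ▸ h.map hX hU

variable {Ω : Type*} [PseudoMetricSpace Ω] [MeasurableSpace Ω] [BorelSpace Ω] {μ : Measure Ω}
  [IsProbabilityMeasure μ] {p : ℕ → Ω}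

theorem ae_mem_support_of_tendsto_empMeasure (hweak : ∀ g : BoundedContinuousFunction Ω ℂ,
      Tendsto (fun n => ∫ ω, g ω ∂(empMeasure p n)) atTop (𝓝 (∫ ω, g ω ∂μ))) :
    ∀ᵐ ω ∂μ, ω ∈ μ.support := by
  have hlim : Tendsto (β := ProbabilityMeasure Ω) (fun n => ⟨empMeasure p (n + 1), inferInstance⟩)
      atTop (𝓝 ⟨μ, inferInstance⟩) :=
    (ProbabilityMeasure.tendsto_iff_forall_integral_rclike_tendsto ℂ).2 fun g =>
      (tendsto_add_atTop_iff_nat 1).2 (hweak g)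
  refine ae_mem_support_of_ae_mem_isSeparable (countable_range p).isSeparable.closure
    (ae_mem_of_isClosed_of_tendsto hlim isClosed_closure fun n => ?_)
  exact ae_empMeasure_mem isClosed_closure.measurableSet
    (fun j => subset_closure (mem_range_self j)) (n + 1)

end Empirical

/-! ### The regression function -/

section Regression

variable {S T : Type*} [MeasurableSpace S] [MeasurableSpace T] {μ : Measure S} {X : S → T}

theorem unifIntegrable_of_ae_norm_le {ι E : Type*} [NormedAddCommGroup E] {p : ℝ≥0∞} (hp : 1 ≤ p)
    (hp' : p ≠ ∞) {f : ι → S → E} (hf : ∀ i, AEStronglyMeasurable (f i) μ) {C : ℝ}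
    (hC : ∀ i, ∀ᵐ s ∂μ, ‖f i s‖ ≤ C) : UnifIntegrable f p μ := by
  refine unifIntegrable_of hp hp' hf fun ε _ => ⟨C.toNNReal + 1, fun i => ?_⟩
  have hzero : {s | C.toNNReal + 1 ≤ ‖f i s‖₊}.indicator (f i) =ᵐ[μ] 0 := by
    filter_upwards [hC i] with s hs
    refine indicator_of_notMem (fun hle => ?_) _
    have hfC : ‖f i s‖₊ ≤ C.toNNReal :=
      NNReal.coe_le_coe.1 (hs.trans (Real.le_coe_toNNReal C))
    exact (hfC.trans_lt (lt_add_one _)).not_ge hle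
  rw [eLpNorm_congr_ae hzero, eLpNorm_zero]
  exact zero_le

variable [IsFiniteMeasure μ]

theorem setIntegral_preimage_regression (hX : Measurable X) {g : S → ℂ} (hg : MemLp g 2 μ)
    {B : Set T} (hB : MeasurableSet B) :
    ∫ s in X ⁻¹' B, regression μ hX g (X s) ∂μ = ∫ s in X ⁻¹' B, g s ∂μ := by
  have hpull : pullback μ hX (indicatorConstLp 2 hB (measure_ne_top _ B) (1 : ℂ)) =
      indicatorConstLp 2 (hX hB) (measure_ne_top μ _) (1 : ℂ) :=
    Lp.indicatorConstLp_compMeasurePreserving hB _ 1 (hX.measurePreserving μ)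
  calc ∫ s in X ⁻¹' B, regression μ hX g (X s) ∂μ
      = ∫ x in B, regression μ hX g x ∂μ.map X :=
        (setIntegral_map hB (Lp.aestronglyMeasurable _) hX.aemeasurable).symm
    _ = ∫ s in X ⁻¹' B, hg.toLp g s ∂μ := by
        rw [← L2.inner_indicatorConstLp_one (𝕜 := ℂ) hB (measure_ne_top _ B), regression_eq hX hg,
          ContinuousLinearMap.adjoint_inner_right, hpull, L2.inner_indicatorConstLp_one]
    _ = ∫ s in X ⁻¹' B, g s ∂μ := integral_congr_ae (ae_restrict_of_ae hg.coeFn_toLp)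

theorem regression_comp_ae_eq_condExp (hX : Measurable X) {g : S → ℂ} (hg : MemLp g 2 μ) :
    (fun s => regression μ hX g (X s)) =ᵐ[μ] μ[g | MeasurableSpace.comap X inferInstance] := by
  have hmem : MemLp (fun s => regression μ hX g (X s)) 2 μ :=
    (Lp.memLp (regression μ hX g)).comp_measurePreserving (hX.measurePreserving μ)
  refine ae_eq_condExp_of_forall_setIntegral_eq hX.comap_le (hg.integrable one_le_two)
    (fun _ _ _ => (hmem.integrable one_le_two).integrableOn) ?_ ?_
  · rintro _ ⟨B, hB, rfl⟩ _
    exact setIntegral_preimage_regression hX hg hB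
  · exact ((Lp.stronglyMeasurable (regression μ hX g)).comp_measurable
      (comap_measurable X)).aestronglyMeasurable

theorem continuous_toLp_of_ae_norm_le {P E : Type*} [TopologicalSpace P] [SequentialSpace P]
    [NormedAddCommGroup E] {p : ℝ≥0∞} [Fact (1 ≤ p)] (hp : p ≠ ∞) {g : P → S → E}
    (hg : ∀ t, MemLp (g t) p μ) {C : ℝ} (hC : ∀ t, ∀ᵐ s ∂μ, ‖g t s‖ ≤ C)
    (hcont : ∀ s, Continuous fun t => g t s) : Continuous fun t => (hg t).toLp (g t) := by
  refine SeqContinuous.continuous fun u t hu => ?_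
  refine (Lp.tendsto_Lp_iff_tendsto_eLpNorm'' (fun n => g (u n)) (fun n => hg (u n)) (g t)
    (hg t)).2 ?_
  exact tendsto_Lp_finite_of_tendsto_ae Fact.out hp (fun n => (hg (u n)).1) (hg t)
    (unifIntegrable_of_ae_norm_le Fact.out hp (fun n => (hg (u n)).1) fun n => hC (u n))
    (Eventually.of_forall fun s => ((hcont s).tendsto t).comp hu)

theorem continuous_regression (hX : Measurable X) {P : Type*} [TopologicalSpace P]
    [SequentialSpace P] {g : P → S → ℂ} (hg : ∀ t, MemLp (g t) 2 μ) {C : ℝ}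
    (hC : ∀ t, ∀ᵐ s ∂μ, ‖g t s‖ ≤ C) (hcont : ∀ s, Continuous fun t => g t s) :
    Continuous fun t => regression μ hX (g t) := by
  simp only [regression_eq hX (hg _)]
  exact (ContinuousLinearMap.continuous _).comp
    (continuous_toLp_of_ae_norm_le ENNReal.ofNat_ne_top hg hC hcont)

end Regression

/-! ### Convergence of the target functions -/

theorem tendstoUniformlyOn_incl_idealTarget {Ω 𝒳 𝓚 P : Type*} [MeasurableSpace Ω]
    [MeasurableSpace 𝒳] [NormedAddCommGroup 𝓚] [InnerProductSpace ℂ 𝓚] [CompleteSpace 𝓚]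
    [RKHS ℂ 𝓚 𝒳 ℂ] {μ : Measure Ω} {X : Ω → 𝒳} (hX : Measurable X) {lam : ℕ → ℝ}
    {φ : ℕ → Lp ℂ 2 (μ.map X)} (heig : IsEigensystem (kernelOp 𝓚 (μ.map X)) lam φ)
    (hpos : IsL2StrictlyPositive 𝓚 (μ.map X)) {g : P → Ω → ℂ} {s : Set P}
    (hs : IsCompact ((fun t => regression μ hX (g t)) '' s)) :
    TendstoUniformlyOn (fun ℓ t => incl 𝓚 (μ.map X) (idealTarget μ hX 𝓚 lam φ (g t) ℓ))
      (fun t => regression μ hX (g t)) atTop s := by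
  have hker : ∀ f, kernelOp 𝓚 (μ.map X) f = 0 → f = 0 := by
    intro f hf
    by_contra hne
    have hlt := hpos f hne
    rw [hf, inner_zero_right] at hlt
    exact lt_irrefl _ hlt
  have hlim := (IsEigensystem.tendstoUniformlyOn_apply_target heig hker hs).comp
    fun t => regression μ hX (g t)
  exact hlim.mono (subset_preimage_image _ s)

section EmpiricalTarget

variable {Ω 𝒳 : Type*} [TopologicalSpace Ω] [MeasurableSpace Ω] [BorelSpace Ω]
  [MetricSpace 𝒳] [MeasurableSpace 𝒳] [BorelSpace 𝒳] {μ : Measure Ω} {X : Ω → 𝒳} {p : ℕ → Ω}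
  {U : Set 𝒳} {𝓚 : Type*} [NormedAddCommGroup 𝓚] [InnerProductSpace ℂ 𝓚] [CompleteSpace 𝓚]
  [RKHS ℂ 𝓚 𝒳 ℂ] {𝓚ₙ : ℕ → Type*} [∀ n, NormedAddCommGroup (𝓚ₙ n)]
  [∀ n, InnerProductSpace ℂ (𝓚ₙ n)] [∀ n, CompleteSpace (𝓚ₙ n)] [∀ n, RKHS ℂ (𝓚ₙ n) 𝒳 ℂ]

theorem RKHSConvergesOn.tendstoUniformlyOn_cfc_empRegression [MeasurableSingletonClass Ω]
    (h : RKHSConvergesOn atTop 𝓚ₙ 𝓚 (empMeasure fun j => X (p j)) (μ.map X) U)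
    (hp : WeaklyConvergesOn atTop (empMeasure p) μ (X ⁻¹' U)) (hX : Continuous X) {w : Ω → ℂ}
    (hw : Continuous w) (hwU : ∃ C, ∀ s, X s ∈ U → ‖w s‖ ≤ C) {y : ℕ → ℂ} {q : ℕ}
    (hy : ∀ j, y (j + q) = w (p j)) {f : ℝ → ℝ} (hf : Continuous f) :
    TendstoUniformlyOn
      (fun n x => (cfc f (covOp (𝓚ₙ n) (empMeasure (fun j => X (p j)) n))
        (adjoint (incl (𝓚ₙ n) (empMeasure (fun j => X (p j)) n))
          (empRegression (fun j => X (p j)) y q n))) x)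
      (fun x => (cfc f (covOp 𝓚 (μ.map X))
        (adjoint (incl 𝓚 (μ.map X)) (regression μ hX.measurable w))) x) atTop U := by
  have hlim := h.tendstoUniformlyOn_integral_cfcKernel_mul hX (hp.smul_empMeasure_sub q) hw hwU hf
  refine (hlim.congr (Eventually.of_forall fun n x _ => ?_)).congr_right fun x _ => ?_
  · exact (integral_mul_analogVec hy n fun s => cfcKernel (𝓚ₙ n) _ f x (X s)).symm.trans
      (cfc_adjoint_regression_apply (X := fun j : Fin n => X (p j)) Measurable.of_discrete
        (h.memLp n) (memLp_indexMeasure n (analogVec y q n)) f x).symm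
  · exact (cfc_adjoint_regression_apply hX.measurable h.memLp_limit
      (hp.memLp_limit hw hwU 2) f x).symm

theorem RKHSConvergesOn.tendstoUniformlyOn_empTarget [MeasurableSingletonClass Ω]
    (h : RKHSConvergesOn atTop 𝓚ₙ 𝓚 (empMeasure fun j => X (p j)) (μ.map X) U)
    (hp : WeaklyConvergesOn atTop (empMeasure p) μ (X ⁻¹' U)) (hX : Continuous X)
    {lam : ℕ → ℝ} {φ : ℕ → Lp ℂ 2 (μ.map X)}
    (heig : IsEigensystem (kernelOp 𝓚 (μ.map X)) lam φ) {lamₙ : ℕ → ℕ → ℝ}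
    {φₙ : ∀ n, ℕ → Lp ℂ 2 (empMeasure (fun j => X (p j)) n)}
    (heigₙ : ∀ n, IsEigensystem (kernelOp (𝓚ₙ n) (empMeasure (fun j => X (p j)) n))
      (lamₙ n) (φₙ n)) {ℓ : ℕ} (hℓ : 1 ≤ ℓ) (hgap : lam ℓ < lam (ℓ - 1)) {w : Ω → ℂ}
    (hw : Continuous w) (hwU : ∃ C, ∀ s, X s ∈ U → ‖w s‖ ≤ C) {y : ℕ → ℂ} {q : ℕ}
    (hy : ∀ j, y (j + q) = w (p j)) :
    TendstoUniformlyOn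
      (fun n x => empTarget (fun j => X (p j)) y n (𝓚ₙ n) (lamₙ n) (φₙ n) q ℓ x)
      (fun x => idealTarget μ hX.measurable 𝓚 lam φ w ℓ x) atTop U := by
  obtain ⟨m, rfl⟩ := Nat.exists_eq_add_of_le' hℓ
  exact h.tendstoUniformlyOn_target heigₙ heig hgap fun f hf =>
    h.tendstoUniformlyOn_cfc_empRegression hp hX hw hwU hy hf

end EmpiricalTarget

/-! ### Sampling along an orbit -/

theorem finite_setOf_natCast_mul_mem {Δt : ℝ≥0} (hΔt : 0 < Δt) {T : Set ℝ≥0} (hT : IsCompact T) :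
    {q : ℕ | q * Δt ∈ T}.Finite := by
  obtain ⟨R, hR⟩ := hT.bddAbove
  obtain ⟨N, hN⟩ := exists_nat_gt (R / Δt)
  refine (Set.finite_Iic N).subset fun q hq => ?_
  have hle : (q : ℝ≥0) ≤ R / Δt := (le_div_iff₀ hΔt).2 (hR hq)
  exact_mod_cast (hle.trans_lt hN).le

theorem finite_inter_setOf_eq_natCast_mul {Δt : ℝ≥0} (hΔt : 0 < Δt) {T : Set ℝ≥0}
    (hT : IsCompact T) : (T ∩ {τ | ∃ q : ℕ, τ = q * Δt}).Finite := by
  refine ((finite_setOf_natCast_mul_mem hΔt hT).image fun q : ℕ => q * Δt).subset ?_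
  rintro _ ⟨hτ, q, rfl⟩
  exact ⟨q, hτ, rfl⟩

theorem tendstoUniformlyOn_finite_prod {ι A P E : Type*} [UniformSpace E] {l : Filter ι}
    {F : ι → A → P → E} {f : A → P → E} {s : Set A} {T : Set P} (hs : s.Finite)
    (h : ∀ a ∈ s, TendstoUniformlyOn (fun n => F n a) (f a) l T) :
    TendstoUniformlyOn (fun n (q : A × P) => F n q.1 q.2) (fun q => f q.1 q.2) l (s ×ˢ T) := by
  intro v hv
  filter_upwards [(Set.Finite.eventually_all hs).2 fun a ha => h a ha v hv] with n hn q hq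
  exact hn q.1 hq.1 q.2 hq.2

theorem orbit_add {Ω : Type*} {Φ : ℝ≥0 → Ω → Ω} (hΦ : ∀ s t, Φ (s + t) = Φ s ∘ Φ t) (Δt : ℝ≥0)
    (ω₁ : Ω) (j q : ℕ) : orbit Φ Δt ω₁ (j + q) = Φ (q * Δt) (orbit Φ Δt ω₁ j) := by
  rw [orbit, orbit, Nat.cast_add, add_comm, add_mul, hΦ, Function.comp_apply]

end

end KAF

theorem mainTheorem1
    {Ω 𝒳 : Type*} [MetricSpace Ω] [MeasurableSpace Ω] [BorelSpace Ω]
    [MetricSpace 𝒳] [MeasurableSpace 𝒳] [BorelSpace 𝒳]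
    -- the invariant measure, with compact support
    (μ : Measure Ω) [IsProbabilityMeasure μ] (hμ : IsCompact μ.support)
    -- the dynamics: a semigroup of continuous measure-preserving maps
    (Φ : ℝ≥0 → Ω → Ω) (hΦ0 : Φ 0 = id) (hΦadd : ∀ s t, Φ (s + t) = Φ s ∘ Φ t)
    (hΦc : ∀ t, Continuous (Φ t)) (hΦμ : ∀ t, MeasurePreserving (Φ t) μ μ)
    -- covariate and response
    (X : Ω → 𝒳) (hX : Continuous X) (Y : Ω → ℂ) (hY : Continuous Y)
    -- the training orbit, and weak convergence of its empirical measures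
    (Δt : ℝ≥0) (hΔt : 0 < Δt) (ω₁ : Ω)
    (hweak : ∀ g : BoundedContinuousFunction Ω ℂ,
      Tendsto (fun n => ∫ ω, g ω ∂(KAF.empMeasure (KAF.orbit Φ Δt ω₁) n)) atTop
        (𝓝 (∫ ω, g ω ∂μ)))
    -- the compact set containing the covariate data and the support of its limit law
    (U : Set 𝒳) (hU : IsCompact U) (hUsupp : (μ.map X).support ⊆ U)
    (hUdata : ∀ j, X (KAF.orbit Φ Δt ω₁ j) ∈ U)
    (hYbdd : ∀ q : ℕ, ∃ C : ℝ, ∀ ω, X ω ∈ U → ‖Y (Φ (q * Δt) ω)‖ ≤ C)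
    -- the ideal and the empirical reproducing kernel Hilbert spaces, with continuous kernels
    (𝓚 : Type*) [NormedAddCommGroup 𝓚] [InnerProductSpace ℂ 𝓚] [CompleteSpace 𝓚]
    [RKHS ℂ 𝓚 𝒳 ℂ]
    (𝓚Emp : ℕ → Type*) [∀ n, NormedAddCommGroup (𝓚Emp n)] [∀ n, InnerProductSpace ℂ (𝓚Emp n)]
    [∀ n, CompleteSpace (𝓚Emp n)] [∀ n, RKHS ℂ (𝓚Emp n) 𝒳 ℂ]
    (hk : Continuous fun p : 𝒳 × 𝒳 => KAF.scalarKernel 𝓚 p.1 p.2)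
    (hkEmp : ∀ n, Continuous fun p : 𝒳 × 𝒳 => KAF.scalarKernel (𝓚Emp n) p.1 p.2)
    (hkconv : TendstoUniformlyOn
      (fun n (p : 𝒳 × 𝒳) => KAF.scalarKernel (𝓚Emp n) p.1 p.2)
      (fun p => KAF.scalarKernel 𝓚 p.1 p.2) atTop (U ×ˢ U))
    -- eigenvalues and orthonormal eigenfunctions of the integral operators
    (lam : ℕ → ℝ) (φ : ℕ → Lp ℂ 2 (μ.map X))
    (heig : KAF.IsEigensystem (KAF.kernelOp 𝓚 (μ.map X)) lam φ)
    (lamEmp : ℕ → ℕ → ℝ)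
    (φEmp : ∀ n, ℕ → Lp ℂ 2 (KAF.empMeasure (fun j => X (KAF.orbit Φ Δt ω₁ j)) n))
    (heigEmp : ∀ n, KAF.IsEigensystem
      (KAF.kernelOp (𝓚Emp n) (KAF.empMeasure (fun j => X (KAF.orbit Φ Δt ω₁ j)) n))
      (lamEmp n) (φEmp n)) :
    -- the regression function represents the conditional expectation
    (∀ τ, MemLp (Y ∘ Φ τ) 2 μ ∧
      (fun ω => KAF.regression μ hX.measurable (Y ∘ Φ τ) (X ω))
        =ᵐ[μ] μ[Y ∘ Φ τ | MeasurableSpace.comap X inferInstance]) ∧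
    -- convergence of the empirical to the ideal target functions, uniformly on `U`,
    -- for each lead time, and uniformly over the lead times in compact sets
    (∀ ℓ : ℕ, 1 ≤ ℓ → 0 < lam (ℓ - 1) → lam ℓ < lam (ℓ - 1) →
      (∀ q : ℕ, TendstoUniformlyOn
        (fun n x => KAF.empTarget (fun j => X (KAF.orbit Φ Δt ω₁ j))
          (fun j => Y (KAF.orbit Φ Δt ω₁ j)) n (𝓚Emp n) (lamEmp n) (φEmp n) q ℓ x)
        (fun x => KAF.idealTarget μ hX.measurable 𝓚 lam φ (Y ∘ Φ (q * Δt)) ℓ x) atTop U) ∧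
      ∀ T : Set ℝ≥0, IsCompact T → TendstoUniformlyOn
        (fun n (p : ℕ × 𝒳) => KAF.empTarget (fun j => X (KAF.orbit Φ Δt ω₁ j))
          (fun j => Y (KAF.orbit Φ Δt ω₁ j)) n (𝓚Emp n) (lamEmp n) (φEmp n) p.1 ℓ p.2)
        (fun p => KAF.idealTarget μ hX.measurable 𝓚 lam φ (Y ∘ Φ (p.1 * Δt)) ℓ p.2) atTop
        ({q : ℕ | q * Δt ∈ T} ×ˢ U)) ∧
    -- convergence of the ideal target functions to the regression function in `L²`,
    -- for each lead time, and uniformly over the lead times in compact sets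
    (KAF.IsL2StrictlyPositive 𝓚 (μ.map X) →
      (∀ τ, Tendsto
        (fun ℓ => KAF.incl 𝓚 (μ.map X)
          (KAF.idealTarget μ hX.measurable 𝓚 lam φ (Y ∘ Φ τ) ℓ)) atTop
        (𝓝 (KAF.regression μ hX.measurable (Y ∘ Φ τ)))) ∧
      (∀ T : Set ℝ≥0, IsCompact T → TendstoUniformlyOn
        (fun ℓ τ => KAF.incl 𝓚 (μ.map X)
          (KAF.idealTarget μ hX.measurable 𝓚 lam φ (Y ∘ Φ τ) ℓ))
        (fun τ => KAF.regression μ hX.measurable (Y ∘ Φ τ)) atTop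
        (T ∩ {τ | ∃ q : ℕ, τ = q * Δt})) ∧
      ((∀ ω, Continuous fun t => Φ t ω) → ∀ T : Set ℝ≥0, IsCompact T → TendstoUniformlyOn
        (fun ℓ τ => KAF.incl 𝓚 (μ.map X)
          (KAF.idealTarget μ hX.measurable 𝓚 lam φ (Y ∘ Φ τ) ℓ))
        (fun τ => KAF.regression μ hX.measurable (Y ∘ Φ τ)) atTop T)) := by
  have hsupp : ∀ᵐ ω ∂μ, ω ∈ μ.support := KAF.ae_mem_support_of_tendsto_empMeasure hweak
  have hp : KAF.WeaklyConvergesOn atTop (KAF.empMeasure (KAF.orbit Φ Δt ω₁)) μ (X ⁻¹' U) :=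
    .of_boundedContinuous (KAF.empMeasure_univ_le_one _) prob_le_one
      (KAF.ae_empMeasure_mem (hU.measurableSet.preimage hX.measurable) hUdata)
      (hsupp.mono fun ω hω => hUsupp (KAF.mem_support_map_of_mem_support hX hω)) hweak
  have hconv : KAF.RKHSConvergesOn atTop 𝓚Emp 𝓚
      (KAF.empMeasure fun j => X (KAF.orbit Φ Δt ω₁ j)) (μ.map X) U :=
    ⟨hU, hp.map_empMeasure hX hU.measurableSet, hkEmp, hk, hkconv⟩
  obtain ⟨M, hM⟩ := hμ.exists_bound_of_continuousOn hY.continuousOn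
  have hbound τ : ∀ᵐ ω ∂μ, ‖(Y ∘ Φ τ) ω‖ ≤ M :=
    (hΦμ τ).quasiMeasurePreserving.ae (hsupp.mono hM)
  have hcont τ : Continuous (Y ∘ Φ τ) := hY.comp (hΦc τ)
  have hL τ : MemLp (Y ∘ Φ τ) 2 μ :=
    MemLp.of_bound (hcont τ).aestronglyMeasurable M (hbound τ)
  refine ⟨fun τ => ⟨hL τ, KAF.regression_comp_ae_eq_condExp hX.measurable (hL τ)⟩,
    fun ℓ hℓ _ hgap => ?_, fun hpos => ?_⟩
  · have hemp (q : ℕ) := hconv.tendstoUniformlyOn_empTarget hp hX heig heigEmp hℓ hgap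
      (hcont (q * Δt)) (hYbdd q) (y := fun j => Y (KAF.orbit Φ Δt ω₁ j))
      fun j => congrArg Y (KAF.orbit_add hΦadd Δt ω₁ j q)
    exact ⟨hemp, fun T hT => KAF.tendstoUniformlyOn_finite_prod
      (KAF.finite_setOf_natCast_mul_mem hΔt hT) fun q _ => hemp q⟩
  · have hideal {S : Set ℝ≥0} := KAF.tendstoUniformlyOn_incl_idealTarget (s := S)
      (g := fun τ => Y ∘ Φ τ) hX.measurable heig hpos
    refine ⟨fun τ => tendstoUniformlyOn_singleton_iff_tendsto.1 (hideal (S := {τ}) ?_),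
      fun T hT => hideal ?_, fun hΦt T hT => hideal ?_⟩
    · exact (finite_singleton τ).image _ |>.isCompact
    · exact (KAF.finite_inter_setOf_eq_natCast_mul hΔt hT).image _ |>.isCompact
    · exact hT.image (KAF.continuous_regression hX.measurable hL hbound fun ω => hY.comp (hΦt ω))
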